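/- Let $k$ be an algebraically closed field and let $\mathfrak a$ be a finite $k$-variety, i.e. a $k$-linear additive category with finite-dimensional Hom-spaces in which idempotents split. A right $\mathfrak a$-module is a contravariant $k$-linear functor from $\mathfrak a$ to $k$-vector spaces, and $\operatorname{mod}\mathfrak a$ denotes the category of those right $\mathfrak a$-modules $M$ that are finitely presented, i.e. for which there is an exact sequence $\mathfrak a(-,A)\to\mathfrak a(-,B)\to M\to 0$ with $A,B\in\mathfrak a$. An abelian category is hereditary if $\operatorname{Ext}^i$ vanishes on it for all $i\geq 2$. A $k$-linear abelian category $\mathcal A$ has Serre duality if its bounded derived category $\mathcal D=D^b(\mathcal A)$ is Hom-finite and has a Serre functor, i.e. an additive auto-equivalence $\mathbb S:\mathcal D\to\mathcal D$ with isomorphisms of vector spaces $\operatorname{Hom}(X,Y)\cong\operatorname{Hom}(Y,\mathbb S X)^*$ natural in $X,Y\in\mathcal D$, where $(-)^*=\operatorname{Hom}_k(-,k)$. The variety $\mathfrak a$ is semi-hereditary if $\operatorname{mod}\mathfrak a$ is abelian and hereditary, and it is dualizing if the contravariant functor $D$ given by $D(M)(x)=\operatorname{Hom}_k(M(x),k)$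 restricts to a duality $\operatorname{mod}\mathfrak a\to\operatorname{mod}\mathfrak a^{\circ}$, where $\mathfrak a^\circ$ is the opposite category. Then $\operatorname{mod}\mathfrak a$ is abelian, hereditary and has Serre duality if and only if $\mathfrak a$ is a semi-hereditary dualizing $k$-variety. -/

import Mathlib

open CategoryTheory Limits Opposite

universe u v w

namespace FiniteVariety

/-- A finite `k`-variety: a Hom-finite additive `k`-linear category in which idempotents split. -/
class IsFiniteVariety (k : Type w) [Field k] (C : Type u) [Category.{v} C] [Preadditive C]
    [Linear k C] : Prop where
  hasFiniteBiproducts : HasFiniteBiproducts C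
  isIdempotentComplete : IsIdempotentComplete C
  homFinite : ∀ X Y : C, Module.Finite k (X ⟶ Y)

/-- The opposite of a `k`-linear category is `k`-linear, with `a • f.op = (a • f).op`. -/
instance linearOpposite (k : Type w) [Field k] (C : Type u) [Category.{v} C] [Preadditive C]
    [Linear k C] : Linear k Cᵒᵖ where
  homModule X Y :=
    { smul := fun a f => (a • f.unop).op
      one_smul := fun f => Quiver.Hom.unop_inj (one_smul k f.unop)
      mul_smul := fun a b f => Quiver.Hom.unop_inj (mul_smul a b f.unop)
      smul_zero := fun a => Quiver.Hom.unop_inj (smul_zero (A := Y.unop ⟶ X.unop) a)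
      smul_add := fun a f g => Quiver.Hom.unop_inj (smul_add a f.unop g.unop)
      add_smul := fun a b f => Quiver.Hom.unop_inj (add_smul a b f.unop)
      zero_smul := fun f => Quiver.Hom.unop_inj (zero_smul k f.unop) }
  smul_comp _ _ _ a f g := Quiver.Hom.unop_inj (Linear.comp_smul _ _ _ g.unop a f.unop)
  comp_smul _ _ _ f a g := Quiver.Hom.unop_inj (Linear.smul_comp _ _ _ a g.unop f.unop)

/-! ### Abelian categories, hereditary categories -/

/-- The property of a preadditive category of being abelian. -/
class IsAbelian (A : Type u) [Category.{v} A] [Preadditive A] : Prop where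
  hasFiniteProducts : HasFiniteProducts A
  hasKernels : HasKernels A
  hasCokernels : HasCokernels A
  isNormalMonoCategory : IsNormalMonoCategory A
  isNormalEpiCategory : IsNormalEpiCategory A

/-- The abelian category with the given preadditive structure. -/
abbrev IsAbelian.toAbelian (A : Type u) [Category.{v} A] [inst : Preadditive A] (h : IsAbelian A) :
    Abelian A where
  toPreadditive := inst
  toIsNormalMonoCategory := h.isNormalMonoCategory
  toIsNormalEpiCategory := h.isNormalEpiCategory
  has_finite_products := h.hasFiniteProducts
  has_kernels := h.hasKernels
  has_cokernels := h.hasCokernels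

/-- An abelian category is hereditary if it has global dimension at most one, that is, if
`Ext^i(X, Y) = 0` for all objects `X`, `Y` and all `i ≥ 2`. -/
def IsHereditary (A : Type u) [Category.{v} A] [Abelian A] : Prop :=
  ∀ X : A, HasProjectiveDimensionLE X 1

/-! ### Serre duality -/

/-- A Serre functor on a `k`-linear category `C`: an additive auto-equivalence `S` together with
isomorphisms `Hom(X, Y) ≅ Hom(Y, S X)^*` of vector spaces which are natural in `X` and `Y`. -/
structure SerreFunctor (k : Type w) [Field k] (C : Type u) [Category.{v} C] [Preadditive C]
    [Linear k C] where
  /-- the auto-equivalence -/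
  S : C ≌ C
  additive : S.functor.Additive
  /-- the duality isomorphisms -/
  iso : ∀ X Y : C, (X ⟶ Y) ≃ₗ[k] Module.Dual k (Y ⟶ S.functor.obj X)
  iso_naturality_left : ∀ {X' X Y : C} (f : X' ⟶ X) (g : X ⟶ Y) (t : Y ⟶ S.functor.obj X'),
    iso X' Y (f ≫ g) t = iso X Y g (t ≫ S.functor.map f)
  iso_naturality_right : ∀ {X Y Y' : C} (g : X ⟶ Y) (h : Y ⟶ Y') (t : Y' ⟶ S.functor.obj X),
    iso X Y' (g ≫ h) t = iso X Y g (h ≫ t)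

/-- A `k`-linear category has Serre duality if it is Hom-finite and admits a Serre functor. -/
def HasSerreDuality (k : Type w) [Field k] (C : Type u) [Category.{v} C] [Preadditive C]
    [Linear k C] : Prop :=
  (∀ X Y : C, Module.Finite k (X ⟶ Y)) ∧ Nonempty (SerreFunctor k C)

/-- The bounded derived category of an abelian category: the full subcategory of the derived
category consisting of the complexes with bounded cohomology. -/
abbrev BoundedDerivedCategory (A : Type u) [Category.{v} A] [Abelian A]
    [HasDerivedCategory.{w} A] :=
  (DerivedCategory.TStructure.t (C := A)).bounded.FullSubcategory

/-- A `k`-linear abelian category satisfies Serre duality if its bounded derived category does. -/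
def AbelianHasSerreDuality (k : Type w) [Field k] (A : Type u) [Category.{v} A] [Abelian A]
    [Linear k A] : Prop :=
  letI := HasDerivedCategory.standard A
  HasSerreDuality k (BoundedDerivedCategory A)

/-! ### Finitely presented modules -/

section Modules

variable (k : Type v) [Field k] (C : Type u) [Category.{v} C] [Preadditive C] [Linear k C]

/-- A contravariant functor `M` from `C` to `k`-vector spaces is finitely presented (by standard
projectives) if there is an exact sequence `C(-, A) ⟶ C(-, B) ⟶ M ⟶ 0`. -/
def finitelyPresented : ObjectProperty (Cᵒᵖ ⥤ ModuleCat.{v} k) := fun M =>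
  ∃ (A B : C) (f : A ⟶ B) (p : (linearYoneda k C).obj B ⟶ M)
    (w : (linearYoneda k C).map f ≫ p = 0),
    (ShortComplex.mk ((linearYoneda k C).map f) p w).Exact ∧ Epi p

variable {k C} in
/-- Finitely presented functors are automatically `k`-linear, so that they are right modules. -/
lemma finitelyPresented.linear {M : Cᵒᵖ ⥤ ModuleCat.{v} k} (hM : finitelyPresented k C M) :
    M.Additive ∧ ∀ {X Y : C} (a : k) (f : X ⟶ Y), M.map (a • f).op = a • M.map f.op := by
  obtain ⟨A, B, f, p, w, -, hp⟩ := hM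
  have hs : ∀ X, Epi (p.app X) := fun X => inferInstance
  refine ⟨⟨fun {X Y f g} => ?_⟩, fun {X Y} a f => ?_⟩
  · rw [← cancel_epi (p.app X), ← p.naturality]
    simp only [Functor.map_add, Preadditive.add_comp, Preadditive.comp_add, p.naturality]
  · rw [← cancel_epi (p.app (op Y)), ← p.naturality, Linear.comp_smul, ← p.naturality,
      ← Linear.smul_comp]
    congr 1
    ext g
    exact Linear.smul_comp _ _ _ a f g

/-- The category `mod C` of finitely presented right `C`-modules. -/
abbrev FPMod := (finitelyPresented k C).FullSubcategory

/-- The vector space duality `V ↦ Hom_k(V, k)`. -/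
def vectorDual : (ModuleCat.{v} k)ᵒᵖ ⥤ ModuleCat.{v} k where
  obj V := ModuleCat.of k (Module.Dual k V.unop)
  map f := ModuleCat.ofHom f.unop.hom.dualMap

/-- The functor `D` from right `C`-modules to right `Cᵒᵖ`-modules given by
`D(M)(x) = Hom_k(M(x), k)`. -/
def dualFunctor : (Cᵒᵖ ⥤ ModuleCat.{v} k)ᵒᵖ ⥤ (Cᵒᵖᵒᵖ ⥤ ModuleCat.{v} k) :=
  Functor.opHom Cᵒᵖ (ModuleCat.{v} k) ⋙
    (Functor.whiskeringRight Cᵒᵖᵒᵖ (ModuleCat.{v} k)ᵒᵖ (ModuleCat.{v} k)).obj (vectorDual k)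

/-- A finite `k`-variety `C` is dualizing if `D` maps finitely presented right `C`-modules to
finitely presented right `Cᵒᵖ`-modules, and if the contravariant functor `mod C ⟶ mod Cᵒᵖ`
obtained from `D` by restriction is a duality. -/
structure IsDualizing : Prop where
  isFiniteVariety : IsFiniteVariety k C
  dual_mem : ∀ M : (FPMod k C)ᵒᵖ, finitelyPresented k Cᵒᵖ
    (((finitelyPresented k C).ι.op ⋙ dualFunctor k C).obj M)
  isEquivalence : ((finitelyPresented k Cᵒᵖ).lift
    ((finitelyPresented k C).ι.op ⋙ dualFunctor k C) dual_mem).IsEquivalence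

/-- `C` is semi-hereditary if `mod C` is abelian and hereditary. -/
def IsSemiHereditary : Prop :=
  ∃ h : IsAbelian (FPMod k C), letI := h.toAbelian; IsHereditary (FPMod k C)

end Modules

end FiniteVariety

-- Serre duality is handled one object at a time. A Serre pair `(X, Z)` is a functional on Hom(X, Z)
-- making every pairing Hom(X, Y) × Hom(Y, Z) → k nondegenerate, so that Z represents Hom(X, -)^*. A
-- Hom-finite category has a Serre functor exactly when every object is the left and the right
-- member of some Serre pair (`hasSerreDuality_of_serrePairs`, `SerreFunctor.serrePair`).
--
-- Dualizing implies Serre. The duality D turns the representable 𝔞°-module at c into an injective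
-- module I with Hom(Y, I) ≅ Y(c)^*, so (𝔞(-, c), I) is a Serre pair in mod 𝔞. It stays one in the
-- bounded derived category (`SerrePair.single`), because Hom(P, Y) and Hom(Y, I) see only H⁰(Y).
-- The cone of a map between left members is a left member, its partner being the cone of the
-- adjoint map (`SerrePair.nonempty_cone`), and likewise on the right. As mod 𝔞 is hereditary,
-- resolutions of length one reach every module, and truncation then reaches every bounded complex
-- (`hasSerreDuality_boundedDerivedCategory`).
--
-- Serre implies dualizing. Let X be the left partner of M. Global dimension at most one and the
-- t-structure force X to be a two-term complex P₀ → P₁ of representables in degrees 0 and 1. Hence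
-- for projective Q the space Hom(Q, M)^* ≅ Hom(X, Q) is the cokernel of Hom(P₁, Q) → Hom(P₀, Q),
-- which is a finite presentation of DM (`exists_dual_presentation`). Full faithfulness of D is
-- linear algebra. For density, let W be the right partner of 𝔞(-, c): then N = H⁰(W) satisfies DN ≅
-- 𝔞(c, -) (`exists_trace_of_projective`), and every finitely presented 𝔞°-module is D of a kernel
-- of maps between such N (`fpDual_essSurj`).

universe w'

namespace FiniteVariety

/-! ### Serre pairs -/

section SerrePair

variable (k : Type w) [Field k] {C : Type u} [Category.{v} C] [Preadditive C] [Linear k C]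

/-- A Serre pair `(X, Z)` consists of a trace `Hom(X, Z) → k` for which all pairings
`Hom(X, Y) × Hom(Y, Z) → k` are nondegenerate. -/
structure SerrePair (X Z : C) where
  /-- the trace -/
  t : (X ⟶ Z) →ₗ[k] k
  left : ∀ {Y : C} (x : X ⟶ Y), (∀ z : Y ⟶ Z, t (x ≫ z) = 0) → x = 0
  right : ∀ {Y : C} (z : Y ⟶ Z), (∀ x : X ⟶ Y, t (x ≫ z) = 0) → z = 0

variable {k}

namespace SerrePair

variable {X Z : C} (p : SerrePair k X Z)

/-- The bilinear pairing `Hom(X, Y) × Hom(Y, Z) → k` of a Serre pair. -/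
def pairing (Y : C) : (X ⟶ Y) →ₗ[k] (Y ⟶ Z) →ₗ[k] k :=
  (Linear.comp (S := k) X Y Z).compr₂ p.t

@[simp] lemma pairing_apply {Y : C} (x : X ⟶ Y) (z : Y ⟶ Z) :
    p.pairing Y x z = p.t (x ≫ z) := rfl

lemma pairing_injective (Y : C) : Function.Injective (p.pairing Y) :=
  (injective_iff_map_eq_zero _).2 fun x hx => p.left x fun z => LinearMap.congr_fun hx z

lemma pairing_flip_injective (Y : C) : Function.Injective (p.pairing Y).flip :=
  (injective_iff_map_eq_zero _).2 fun z hz => p.right z fun x => LinearMap.congr_fun hz x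

/-- Only Hom(X, Y) has to be finite-dimensional: injectivity into its dual bounds Hom(Y, Z) as well.
-/
lemma isPerfPair (Y : C) [Module.Finite k (X ⟶ Y)] : (p.pairing Y).IsPerfPair :=
  .of_injective (p.pairing_injective Y) (p.pairing_flip_injective Y)

/-- Functionals on `Hom(X, Y)` are represented by morphisms `Y ⟶ Z`. -/
lemma exists_right {Y : C} [Module.Finite k (X ⟶ Y)] (φ : (X ⟶ Y) →ₗ[k] k) :
    ∃ z : Y ⟶ Z, ∀ x, p.t (x ≫ z) = φ x := by
  obtain ⟨z, hz⟩ := (p.isPerfPair Y).bijective_right.2 φ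
  exact ⟨z, fun x => LinearMap.congr_fun hz x⟩

/-- Functionals on `Hom(Y, Z)` are represented by morphisms `X ⟶ Y`. -/
lemma exists_left {Y : C} [Module.Finite k (X ⟶ Y)] (φ : (Y ⟶ Z) →ₗ[k] k) :
    ∃ x : X ⟶ Y, ∀ z, p.t (x ≫ z) = φ z := by
  obtain ⟨x, hx⟩ := (p.isPerfPair Y).bijective_left.2 φ
  exact ⟨x, fun z => LinearMap.congr_fun hx z⟩

/-- Transport of a Serre pair along isomorphisms. -/
def ofIso {X' Z' : C} (e : X ≅ X') (e' : Z ≅ Z') : SerrePair k X' Z' where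
  t := p.t ∘ₗ Linear.leftComp k Z e.hom ∘ₗ Linear.rightComp k X' e'.inv
  left {Y} x hx := by
    have : e.hom ≫ x = 0 := p.left _ fun z => by simpa using hx (z ≫ e'.hom)
    simpa using this
  right {Y} z hz := by
    have : z ≫ e'.inv = 0 := p.right _ fun x => by simpa using hz (e.inv ≫ x)
    simpa using this

/-- The image of a Serre pair under a linear equivalence of categories. -/
noncomputable def map {D : Type*} [Category D] [Preadditive D] [Linear k D] (F : C ⥤ D)
    [F.Additive] [F.Linear k] [F.IsEquivalence] : SerrePair k (F.obj X) (F.obj Z) where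
  t := p.t ∘ₗ (LinearEquiv.ofBijective (F.mapLinearMap k (X := X) (Y := Z))
    ⟨F.map_injective, F.map_surjective⟩).symm.toLinearMap
  left {Y} x hx := by
    obtain ⟨x', hx'⟩ := F.map_surjective (x ≫ (F.objObjPreimageIso Y).inv)
    have : x' = 0 := p.left _ fun z => by
      have h := hx ((F.objObjPreimageIso Y).inv ≫ F.map z)
      rw [← Category.assoc, ← hx', ← F.map_comp] at h
      exact (congrArg p.t ((LinearEquiv.ofBijective (F.mapLinearMap k (X := X) (Y := Z)) _
        ).symm_apply_apply _)).symm.trans h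
    rw [this, F.map_zero] at hx'
    exact (cancel_mono (F.objObjPreimageIso Y).inv).1 (by rw [← hx', zero_comp])
  right {Y} z hz := by
    obtain ⟨z', hz'⟩ := F.map_surjective ((F.objObjPreimageIso Y).hom ≫ z)
    have : z' = 0 := p.right _ fun x => by
      have h := hz (F.map x ≫ (F.objObjPreimageIso Y).hom)
      rw [Category.assoc, ← hz', ← F.map_comp] at h
      exact (congrArg p.t ((LinearEquiv.ofBijective (F.mapLinearMap k (X := X) (Y := Z)) _
        ).symm_apply_apply _)).symm.trans h
    rw [this, F.map_zero] at hz'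
    exact (cancel_epi (F.objObjPreimageIso Y).hom).1 (by rw [← hz', comp_zero])

lemma map_t {D : Type*} [Category D] [Preadditive D] [Linear k D] (F : C ⥤ D)
    [F.Additive] [F.Linear k] [F.IsEquivalence] (y : X ⟶ Z) : (p.map F).t (F.map y) = p.t y :=
  congrArg p.t ((LinearEquiv.ofBijective (F.mapLinearMap k (X := X) (Y := Z)) _).symm_apply_apply y)

end SerrePair

/-! ### From Serre pairs to Serre functors -/

variable [∀ X Y : C, Module.Finite k (X ⟶ Y)]

/-- A category in which every object is on the left and on the right side of a Serre pair has
a Serre functor. -/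
theorem hasSerreDuality_of_serrePairs (hl : ∀ X : C, ∃ Z, Nonempty (SerrePair k X Z))
    (hr : ∀ Z : C, ∃ X, Nonempty (SerrePair k X Z)) : HasSerreDuality k C := by
  refine ⟨inferInstance, ?_⟩
  choose s hs using hl
  let p (X : C) : SerrePair k X (s X) := (hs X).some
  -- S f is the adjoint of precomposition with f under the traces, unique by nondegeneracy.
  have ex {X X' : C} (f : X ⟶ X') : ∃ g : s X ⟶ s X', ∀ r, (p X').t (r ≫ g) = (p X).t (f ≫ r) :=
    (p X').exists_right ((p X).t ∘ₗ Linear.leftComp k (s X) f)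
  let m {X X' : C} (f : X ⟶ X') : s X ⟶ s X' := (ex f).choose
  have hm {X X' : C} (f : X ⟶ X') (r : X' ⟶ s X) : (p X').t (r ≫ m f) = (p X).t (f ≫ r) :=
    (ex f).choose_spec r
  have uniq {X Y : C} (g g' : Y ⟶ s X) (h : ∀ r, (p X).t (r ≫ g) = (p X).t (r ≫ g')) : g = g' :=
    sub_eq_zero.1 ((p X).right _ fun r => by rw [Preadditive.comp_sub, map_sub, h, sub_self])
  let S : C ⥤ C :=
    { obj := s
      map := m
      map_id X := uniq _ _ fun r => by rw [hm, Category.id_comp, Category.comp_id]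
      map_comp f g := uniq _ _ fun r => by
        rw [hm, ← Category.assoc r, hm, ← Category.assoc g, hm, Category.assoc] }
  have hS : S.Additive := ⟨fun {X Y f g} => uniq _ _ fun r => by
    change (p Y).t (r ≫ m (f + g)) = (p Y).t (r ≫ (m f + m g))
    rw [hm, Preadditive.comp_add, map_add, hm, hm, Preadditive.add_comp, map_add]⟩
  have : S.Faithful := ⟨fun {X Y f g} h => by
    refine sub_eq_zero.1 ((p X).left _ fun r => ?_)
    have h' : m f = m g := h
    rw [Preadditive.sub_comp, map_sub, ← hm f, ← hm g, h', sub_self]⟩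
  have : S.Full := ⟨fun {X Y} g => by
    obtain ⟨f, hf⟩ := (p X).exists_left ((p Y).t ∘ₗ Linear.rightComp k Y g)
    exact ⟨f, uniq _ _ fun r => (hm f r).trans (hf r)⟩⟩
  -- Two right partners of the same X represent the same functor; `a` and `b` exchange the traces
  -- and are mutually inverse.
  have : S.EssSurj := ⟨fun Z => by
    obtain ⟨X, ⟨q⟩⟩ := hr Z
    obtain ⟨a, ha⟩ := (p X).exists_right q.t
    obtain ⟨b, hb⟩ := q.exists_right (p X).t
    refine ⟨X, ⟨⟨b, a, uniq _ _ fun r => by rw [← Category.assoc, ha, hb, Category.comp_id], ?_⟩⟩⟩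
    refine sub_eq_zero.1 (q.right _ fun r => ?_)
    rw [Preadditive.comp_sub, map_sub, ← Category.assoc, hb, ha, Category.comp_id, sub_self]⟩
  have : S.IsEquivalence := {}
  exact ⟨{
    S := S.asEquivalence
    additive := hS
    iso X Y := LinearEquiv.ofBijective ((p X).pairing Y) ((p X).isPerfPair Y).bijective_left
    iso_naturality_left {X' X Y} f g (t : Y ⟶ s X') := by
      change (p X').t ((f ≫ g) ≫ t) = (p X).t (g ≫ t ≫ m f)
      rw [← Category.assoc g, hm, Category.assoc]
    iso_naturality_right {X Y Y'} g h (t : Y' ⟶ s X) :=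
      congrArg (p X).t (Category.assoc g h t) }⟩

end SerrePair

/-! ### Serre pairs in triangulated categories -/

section Triangulated

open Pretriangulated

variable {k : Type w} [Field k] {T : Type u} [Category.{v} T] [Preadditive T] [Linear k T]
  [HasShift T ℤ] [∀ n : ℤ, (shiftFunctor T n).Additive]
  [∀ n : ℤ, (shiftFunctor T n).Linear k]

open LinearMap in
/-- A functional which vanishes on the kernel of a linear map factors through it. -/
lemma exists_factor_of_ker {V W : Type*} [AddCommGroup V] [Module k V] [AddCommGroup W]
    [Module k W] (f : V →ₗ[k] W) (φ : V →ₗ[k] k) (h : ∀ x, f x = 0 → φ x = 0) :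
    ∃ ψ : W →ₗ[k] k, ∀ x, ψ (f x) = φ x := by
  have : ker f ≤ ker φ := fun x hx => h x hx
  obtain ⟨ψ, hψ⟩ := LinearMap.exists_extend
    (((ker f).liftQ φ this) ∘ₗ f.quotKerEquivRange.symm.toLinearMap)
  refine ⟨ψ, fun x => ?_⟩
  have := LinearMap.congr_fun hψ ⟨f x, mem_range_self f x⟩
  refine this.trans ?_
  have hx : f.quotKerEquivRange.symm ⟨f x, mem_range_self f x⟩ = (ker f).mkQ x :=
    f.quotKerEquivRange_symm_apply_image x _
  exact (congrArg ((ker f).liftQ φ ‹_›) hx).trans rfl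

variable (k T)

/-- The objects on the left side of a Serre pair. -/
def serreLeft : ObjectProperty T := fun X => ∃ Z, Nonempty (SerrePair k X Z)

/-- The objects on the right side of a Serre pair. -/
def serreRight : ObjectProperty T := fun Z => ∃ X, Nonempty (SerrePair k X Z)

variable {k T}

lemma serreLeft_shift {X : T} (n : ℤ) (hX : serreLeft k T X) : serreLeft k T (X⟦n⟧) :=
  let ⟨_, ⟨p⟩⟩ := hX
  ⟨_, ⟨p.map (shiftFunctor T n)⟩⟩

lemma serreRight_shift {X : T} (n : ℤ) (hX : serreRight k T X) : serreRight k T (X⟦n⟧) :=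
  let ⟨_, ⟨p⟩⟩ := hX
  ⟨_, ⟨p.map (shiftFunctor T n)⟩⟩

instance : (serreLeft k T).IsClosedUnderIsomorphisms where
  of_iso e := fun ⟨Z, ⟨p⟩⟩ => ⟨Z, ⟨p.ofIso e (Iso.refl Z)⟩⟩

instance : (serreRight k T).IsClosedUnderIsomorphisms where
  of_iso e := fun ⟨X, ⟨p⟩⟩ => ⟨X, ⟨p.ofIso (Iso.refl X) e⟩⟩

variable [HasZeroObject T] [Pretriangulated T] [∀ X Y : T, Module.Finite k (X ⟶ Y)]

/-! ### Long exact Hom sequences of a distinguished triangle -/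

section DistinguishedTriangle

omit [Linear k T] [∀ n : ℤ, (shiftFunctor T n).Linear k] [∀ X Y : T, Module.Finite k (X ⟶ Y)]

variable {A B C Y : T} {f : A ⟶ B} {g : B ⟶ C} {h : C ⟶ A⟦(1 : ℤ)⟧}
  (H : Triangle.mk f g h ∈ distTriang T)

include H

lemma distTriang_comp₂₃ : g ≫ h = 0 := comp_distTriang_mor_zero₂₃ _ H

lemma distTriang_comp₃₁ : h ≫ (shiftFunctor T (1 : ℤ)).map f = 0 :=
  comp_distTriang_mor_zero₃₁ _ H

lemma distTriang_yoneda₂ (s : B ⟶ Y) (hs : f ≫ s = 0) : ∃ y : C ⟶ Y, s = g ≫ y :=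
  Triangle.yoneda_exact₂ _ H s hs

lemma distTriang_yoneda₃ (s : C ⟶ Y) (hs : g ≫ s = 0) :
    ∃ y : A⟦(1 : ℤ)⟧ ⟶ Y, s = h ≫ y :=
  Triangle.yoneda_exact₃ _ H s hs

lemma distTriang_coyoneda₂ (z : Y ⟶ B) (hz : z ≫ g = 0) : ∃ u : Y ⟶ A, z = u ≫ f :=
  Triangle.coyoneda_exact₂ _ H z hz

lemma distTriang_coyoneda₃ (z : Y ⟶ C) (hz : z ≫ h = 0) : ∃ u : Y ⟶ B, z = u ≫ g :=
  Triangle.coyoneda_exact₃ _ H z hz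

lemma distTriang_coyoneda₁ (z : Y ⟶ A⟦(1 : ℤ)⟧) (hz : z ≫ (shiftFunctor T (1 : ℤ)).map f = 0) :
    ∃ u : Y ⟶ C, z = u ≫ h :=
  Triangle.coyoneda_exact₁ _ H z hz

/-- The rotated triangle carries -f[1]; the sign is absorbed into `u`. -/
lemma distTriang_coyoneda₂_shift (z : Y ⟶ B⟦(1 : ℤ)⟧)
    (hz : z ≫ (shiftFunctor T (1 : ℤ)).map g = 0) :
    ∃ u : Y ⟶ A⟦(1 : ℤ)⟧, z = u ≫ (shiftFunctor T (1 : ℤ)).map f := by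
  obtain ⟨u, hu⟩ : ∃ u : Y ⟶ A⟦(1 : ℤ)⟧, z = u ≫ (-(shiftFunctor T (1 : ℤ)).map f) :=
    Triangle.coyoneda_exact₁ _ (rot_of_distTriang _ H) z hz
  exact ⟨-u, by rw [hu, Preadditive.comp_neg, Preadditive.neg_comp]⟩

lemma distTriang_morphism₂ {A' B' C' : T} {f' : A' ⟶ B'} {g' : B' ⟶ C'} {h' : C' ⟶ A'⟦(1 : ℤ)⟧}
    (H' : Triangle.mk f' g' h' ∈ distTriang T) (a : A ⟶ A') (c : C ⟶ C')
    (w : h ≫ (shiftFunctor T (1 : ℤ)).map a = c ≫ h') :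
    ∃ b : B ⟶ B', f ≫ b = a ≫ f' ∧ g ≫ c = b ≫ g' :=
  complete_distinguished_triangle_morphism₂ _ _ H H' a c w

end DistinguishedTriangle

/-- Serre pairs are compatible with cones. -/
theorem SerrePair.nonempty_cone {P₁ P₀ X N I₁ I₀ : T} {f : P₁ ⟶ P₀} {p : P₀ ⟶ X}
    {d : X ⟶ P₁⟦(1 : ℤ)⟧} (h : Triangle.mk f p d ∈ distTriang T)
    {j : N ⟶ I₁} {g : I₁ ⟶ I₀} {e : I₀ ⟶ N⟦(1 : ℤ)⟧} (h' : Triangle.mk j g e ∈ distTriang T)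
    (p₁ : SerrePair k P₁ I₁) (p₀ : SerrePair k P₀ I₀)
    (hfg : ∀ r : P₀ ⟶ I₁, p₁.t (f ≫ r) = p₀.t (r ≫ g)) :
    Nonempty (SerrePair k X (N⟦(1 : ℤ)⟧)) := by
  let σ := shiftFunctor T (1 : ℤ)
  let D : (P₁ ⟶ N) →ₗ[k] (X ⟶ N⟦(1 : ℤ)⟧) := Linear.leftComp k _ d ∘ₗ σ.mapLinearMap k
  -- The trace is prescribed on the images of `d` and of `e`. A relation between the two
  -- prescriptions completes to a morphism of triangles, and adjointness of `f` and `g` makes the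
  -- prescriptions compatible.
  obtain ⟨t, ht⟩ : ∃ t : (X ⟶ N⟦(1 : ℤ)⟧) →ₗ[k] k,
      ∀ x, t ((D.coprod (Linear.rightComp k X e)) x) =
        ((p₁.t ∘ₗ Linear.rightComp k P₁ j).coprod (p₀.t ∘ₗ Linear.leftComp k I₀ p)) x := by
    refine exists_factor_of_ker _ _ ?_
    rintro ⟨a, w⟩ hx
    have hx : d ≫ σ.map a + w ≫ e = 0 := hx
    obtain ⟨b, hb₁, hb₂⟩ := distTriang_morphism₂ h h' a (-w) (by
      rw [Preadditive.neg_comp, eq_neg_iff_add_eq_zero, hx])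
    change p₁.t (a ≫ j) + p₀.t (p ≫ w) = 0
    rw [← hb₁, hfg, ← hb₂, Preadditive.comp_neg, map_neg, neg_add_cancel]
  have ht₁ (a : P₁ ⟶ N) : t (d ≫ σ.map a) = p₁.t (a ≫ j) := by
    simpa [D] using ht (a, 0)
  have ht₀ (w : X ⟶ I₀) : t (w ≫ e) = p₀.t (p ≫ w) := by simpa using ht (0, w)
  let q₁ := p₁.map σ
  let q₀ := p₀.map σ
  have hq (a : P₁⟦(1 : ℤ)⟧ ⟶ N⟦(1 : ℤ)⟧) : t (d ≫ a) = q₁.t (a ≫ σ.map j) := by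
    obtain ⟨a, rfl⟩ := σ.map_surjective a
    rw [ht₁, ← Functor.map_comp]
    exact (p₁.map_t _ _).symm
  have hfgq (r : P₀⟦(1 : ℤ)⟧ ⟶ I₁⟦(1 : ℤ)⟧) : q₁.t (σ.map f ≫ r) = q₀.t (r ≫ σ.map g) := by
    obtain ⟨r, rfl⟩ := σ.map_surjective r
    rw [← Functor.map_comp, ← Functor.map_comp]
    exact (p₁.map_t _ _).trans ((hfg r).trans (p₀.map_t _ _).symm)
  refine ⟨⟨t, fun {Y} x hx => ?_, fun {Y} z hz => ?_⟩⟩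
  -- Testing against maps through `e` gives p ≫ x = 0, so x = d ≫ r. Testing against Hom(Y, N[1])
  -- then shows that r factors through f[1], and d ≫ f[1] = 0.
  · obtain ⟨r, rfl⟩ := distTriang_yoneda₃ h x (p₀.left _ fun u => by
      rw [Category.assoc, ← ht₀, Category.assoc, hx])
    obtain ⟨ψ, hψ⟩ := exists_factor_of_ker (Linear.rightComp k Y (σ.map g))
      (q₁.t ∘ₗ Linear.leftComp k (I₁⟦(1 : ℤ)⟧) r) (fun y hy => by
        obtain ⟨z, rfl⟩ := distTriang_coyoneda₂_shift h' y hy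
        change q₁.t (r ≫ z ≫ σ.map j) = 0
        rw [← Category.assoc, ← hq, ← Category.assoc, hx])
    obtain ⟨s, hs⟩ := q₀.exists_left ψ
    have : r = σ.map f ≫ s := sub_eq_zero.1 (q₁.left _ fun y => by
      rw [Preadditive.sub_comp, map_sub, Category.assoc, hfgq, Category.assoc, hs]
      exact sub_eq_zero.2 (hψ y).symm)
    rw [this, ← Category.assoc, distTriang_comp₃₁ h, zero_comp]
  · obtain ⟨u, rfl⟩ := distTriang_coyoneda₁ h' z (q₁.right _ fun x => by
      rw [← Category.assoc, ← hq, ← Category.assoc, hz])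
    obtain ⟨ψ, hψ⟩ := exists_factor_of_ker (Linear.leftComp k Y f)
      (p₀.t ∘ₗ Linear.rightComp k P₀ u) (fun s hs => by
        obtain ⟨y, rfl⟩ := distTriang_yoneda₂ h s hs
        change p₀.t ((p ≫ y) ≫ u) = 0
        rw [Category.assoc, ← ht₀, Category.assoc, hz])
    obtain ⟨v, hv⟩ := p₁.exists_right ψ
    have : u = v ≫ g := sub_eq_zero.1 (p₀.right _ fun s => by
      rw [Preadditive.comp_sub, map_sub, ← Category.assoc, ← hfg, ← Category.assoc, hv]
      exact sub_eq_zero.2 (hψ s).symm)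
    rw [this, Category.assoc, distTriang_comp₂₃ h', comp_zero]

/-- The partner of the cone of `S.mor₁` is the cone of the adjoint map `g` between the partners. -/
lemma serreLeft_obj₃ {S : Triangle T} (hS : S ∈ distTriang T) (h₁ : serreLeft k T S.obj₁)
    (h₂ : serreLeft k T S.obj₂) : serreLeft k T S.obj₃ := by
  obtain ⟨I₁, ⟨p₁⟩⟩ := h₁
  obtain ⟨I₀, ⟨p₀⟩⟩ := h₂
  obtain ⟨g, hg⟩ := p₀.exists_right (p₁.t ∘ₗ Linear.leftComp k I₁ S.mor₁)
  obtain ⟨N, j, e, h'⟩ := distinguished_cocone_triangle₁ g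
  exact ⟨_, SerrePair.nonempty_cone (h := hS) h' p₁ p₀ fun r => (hg r).symm⟩

lemma serreRight_obj₃ {S : Triangle T} (hS : S ∈ distTriang T) (h₁ : serreRight k T S.obj₁)
    (h₂ : serreRight k T S.obj₂) : serreRight k T S.obj₃ := by
  obtain ⟨P₁, ⟨p₁⟩⟩ := h₁
  obtain ⟨P₀, ⟨p₀⟩⟩ := h₂
  obtain ⟨f, hf⟩ := p₁.exists_left (p₀.t ∘ₗ Linear.rightComp k P₀ S.mor₁)
  obtain ⟨X, p, d, h⟩ := distinguished_cocone_triangle f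
  -- `SerrePair.nonempty_cone` gives a partner to a shift N[1], so N is taken to be S.obj₃[-1].
  have h' := inv_rot_of_distTriang _ hS
  obtain ⟨q⟩ := SerrePair.nonempty_cone h h' p₁ p₀ hf
  exact ⟨X, ⟨q.ofIso (Iso.refl X) ((shiftEquiv T (1 : ℤ)).counitIso.app S.obj₃)⟩⟩

/-- The middle term is the cone of X₃[-1] → X₁, so stability under cones and shifts suffices. -/
instance : (serreLeft k T).IsTriangulatedClosed₂ := .mk' fun _ hS h₁ h₃ =>
  serreLeft_obj₃ (inv_rot_of_distTriang _ hS) (serreLeft_shift _ h₃) h₁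

instance : (serreRight k T).IsTriangulatedClosed₂ := .mk' fun _ hS h₁ h₃ =>
  serreRight_obj₃ (inv_rot_of_distTriang _ hS) (serreRight_shift _ h₃) h₁

end Triangulated

/-! ### Bounded objects of the derived category -/

section Derived

open DerivedCategory DerivedCategory.TStructure Pretriangulated Triangulated Abelian

variable {A : Type u} [Category.{v} A] [Abelian A] [HasDerivedCategory.{w} A]

lemma bounded_of_isGE_of_isLE (X : DerivedCategory A) (a b : ℤ) [t.IsGE X a] [t.IsLE X b] :
    t.bounded X := ⟨⟨a, inferInstance⟩, ⟨b, inferInstance⟩⟩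

lemma bounded_single (n : ℤ) (M : A) : t.bounded ((singleFunctor A n).obj M) :=
  bounded_of_isGE_of_isLE _ n n

/-- Dévissage: a property of objects that is closed under extensions holds for all objects with
cohomology in `[a, b]` as soon as it holds for objects with cohomology in a single degree. -/
lemma prop_of_isGE_of_isLE (Q : ObjectProperty (DerivedCategory A)) [Q.IsClosedUnderIsomorphisms]
    [Q.IsTriangulatedClosed₂] (a b : ℤ) (hab : a ≤ b)
    (h : ∀ n, a ≤ n → n ≤ b → ∀ M, Q ((singleFunctor A n).obj M)) (X : DerivedCategory A)
    [t.IsGE X a] [t.IsLE X b] : Q X := by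
  obtain ⟨n, rfl⟩ := Int.le.dest hab
  induction n generalizing X with
  | zero =>
    have : t.IsLE X a := by simpa using ‹t.IsLE X (a + (0 : ℕ))›
    obtain ⟨M, ⟨e⟩⟩ := exists_iso_singleFunctor_obj_of_isGE_of_isLE X a
    exact Q.prop_of_iso e.symm (h a le_rfl hab M)
  | succ n hn =>
    -- The lower truncation has one degree less; the remainder is concentrated in the top degree.
    have h₁ : t.IsLE ((t.truncLT (a + (n + 1 : ℕ))).obj X) (a + n) :=
      t.isLE_truncLT_obj _ _ _ (by grind)
    refine Q.ext_of_isTriangulatedClosed₂ _ (t.triangleLTGE_distinguished (a + (n + 1 : ℕ)) X) ?_ ?_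
    · exact hn ((t.truncLT (a + (n + 1 : ℕ))).obj X) (by lia)
        fun m hm hm' M => h m hm (by grind) M
    · obtain ⟨M, ⟨e⟩⟩ := exists_iso_singleFunctor_obj_of_isGE_of_isLE
        ((t.truncGE (a + (n + 1 : ℕ))).obj X) (a + (n + 1 : ℕ))
      exact Q.prop_of_iso e.symm (h _ hab le_rfl M)

lemma prop_of_bounded (Q : ObjectProperty (DerivedCategory A)) [Q.IsClosedUnderIsomorphisms]
    [Q.IsTriangulatedClosed₂] (h : ∀ n M, Q ((singleFunctor A n).obj M))
    {X : DerivedCategory A} (hX : t.bounded X) : Q X := by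
  obtain ⟨⟨a, _⟩, ⟨b, _⟩⟩ := hX
  -- For a zero object the given bounds need not satisfy a ≤ b.
  have := t.isGE_of_ge X (min a b) a (by simp)
  exact prop_of_isGE_of_isLE Q (min a b) b (by simp) (fun n _ _ => h n) X

lemma prop_of_bounded_of_isLE (Q : ObjectProperty (DerivedCategory A))
    [Q.IsClosedUnderIsomorphisms] [Q.IsTriangulatedClosed₂] (b : ℤ)
    (h : ∀ n ≤ b, ∀ M, Q ((singleFunctor A n).obj M))
    {X : DerivedCategory A} (hX : t.bounded X) [t.IsLE X b] : Q X := by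
  obtain ⟨⟨a, _⟩, -⟩ := hX
  have := t.isGE_of_ge X (min a b) a (by simp)
  exact prop_of_isGE_of_isLE Q (min a b) b (by simp) (fun n _ hn => h n hn) X

lemma prop_of_bounded_of_isGE (Q : ObjectProperty (DerivedCategory A))
    [Q.IsClosedUnderIsomorphisms] [Q.IsTriangulatedClosed₂] (a : ℤ)
    (h : ∀ n ≥ a, ∀ M, Q ((singleFunctor A n).obj M))
    {X : DerivedCategory A} (hX : t.bounded X) [t.IsGE X a] : Q X := by
  obtain ⟨-, ⟨b, _⟩⟩ := hX
  have := t.isLE_of_le X b (max a b) (by simp)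
  exact prop_of_isGE_of_isLE Q a (max a b) (by simp) (fun n hn _ => h n hn) X

/-! ### Vanishing of morphisms -/

/-- With M in degree a and N in degree b these morphisms form Ext^(a-b)(M, N), and a - b ≥ d. -/
lemma singleFunctor_hom_eq_zero [HasExt.{w} A] {M N : A} (d : ℕ)
    (hMN : ∀ i ≥ d, ∀ e : Ext M N i, e = 0) (a b : ℤ) (h : b + d ≤ a)
    (f : (singleFunctor A a).obj M ⟶ (singleFunctor A b).obj N) : f = 0 := by
  obtain ⟨i, hi⟩ := Int.le.dest (show (0 : ℤ) ≤ a - b by lia)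
  let e₁ := ((singleFunctors A).shiftIso a 0 a (by simp)).app M
  let e₂ := ((singleFunctors A).shiftIso a (-i) b (by lia)).app N
  let e₃ := ((singleFunctors A).shiftIso (i : ℤ) (-i) 0 (by simp)).app N
  let g : ShiftedHom ((singleFunctor A 0).obj M) ((singleFunctor A 0).obj N) (i : ℤ) :=
    e₁.inv ≫ f⟦a⟧' ≫ e₂.hom ≫ e₃.inv
  have hg : g = 0 := by
    have := hMN i (by lia) (Ext.homEquiv.symm g)
    rw [← Ext.homEquiv.apply_symm_apply g, this]
    exact Ext.zero_hom _ _ _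
  have hf : (shiftFunctor (DerivedCategory A) a).map f = 0 := by
    have : (shiftFunctor (DerivedCategory A) a).map f = e₁.hom ≫ g ≫ e₃.hom ≫ e₂.inv := by
      simp [g]
    rw [this, hg, zero_comp, comp_zero]
  exact (shiftFunctor (DerivedCategory A) a).map_injective (hf.trans (Functor.map_zero _ _ _).symm)

/-- Right orthogonality to a fixed object is closed under extensions, so dévissage reduces to `Y` in
a single degree. -/
lemma hom_eq_zero_of_isLE {M : A} (d : ℕ) [HasProjectiveDimensionLT M d] (a b : ℤ) (h : b + d ≤ a)
    {Y : DerivedCategory A} (hY : t.bounded Y) [t.IsLE Y b]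
    (f : (singleFunctor A a).obj M ⟶ Y) : f = 0 := by
  have : HasExt.{w} A := hasExt_of_hasDerivedCategory A
  refine prop_of_bounded_of_isLE
    (ObjectProperty.rightOrthogonal (.singleton ((singleFunctor A a).obj M))) b ?_ hY f ⟨()⟩
  rintro n hn N _ g ⟨⟩
  exact singleFunctor_hom_eq_zero d
    (fun i hi e => e.eq_zero_of_hasProjectiveDimensionLT d hi) a n (by lia) g

lemma hom_eq_zero_of_isGE {N : A} (d : ℕ) [HasInjectiveDimensionLT N d] (a b : ℤ) (h : b + d ≤ a)
    {Y : DerivedCategory A} (hY : t.bounded Y) [t.IsGE Y a]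
    (f : Y ⟶ (singleFunctor A b).obj N) : f = 0 := by
  have : HasExt.{w} A := hasExt_of_hasDerivedCategory A
  refine prop_of_bounded_of_isGE
    (ObjectProperty.leftOrthogonal (.singleton ((singleFunctor A b).obj N))) a ?_ hY f ⟨()⟩
  rintro n hn M _ g ⟨⟩
  exact singleFunctor_hom_eq_zero d
    (fun i hi e => e.eq_zero_of_hasInjectiveDimensionLT d hi) n b (by lia) g

lemma hasInjectiveDimensionLT_of_forall (d : ℕ) (h : ∀ M : A, HasProjectiveDimensionLT M d)
    (N : A) : HasInjectiveDimensionLT N d := by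
  have : HasExt.{w} A := hasExt_of_hasDerivedCategory A
  exact HasInjectiveDimensionLT.mk fun i hi M e => e.eq_zero_of_hasProjectiveDimensionLT d hi

/-! ### Covering an object by an object of its top cohomological degree -/

section
open HomologicalComplex

-- In the top degree all chains are cycles, and homology is a quotient of cycles.
omit [HasDerivedCategory A] in
lemma epi_homologyMap_of_epi_f {K L : CochainComplex A ℤ} (φ : K ⟶ L) (n : ℤ)
    [K.IsStrictlyLE n] [L.IsStrictlyLE n] [Epi (φ.f n)] : Epi (homologyMap φ n) := by
  have hK : K.d n (n + 1) = 0 := (K.isZero_of_isStrictlyLE n (n + 1) (by lia)).eq_of_tgt _ _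
  have hL : L.d n (n + 1) = 0 := (L.isZero_of_isStrictlyLE n (n + 1) (by lia)).eq_of_tgt _ _
  have := K.isIso_iCycles n (n + 1) (by simp) hK
  have := L.isIso_iCycles n (n + 1) (by simp) hL
  have : Epi (cyclesMap φ n) := by
    have : Epi (cyclesMap φ n ≫ L.iCycles n) := by
      rw [cyclesMap_i]; infer_instance
    have e : cyclesMap φ n = (cyclesMap φ n ≫ L.iCycles n) ≫ inv (L.iCycles n) := by
      rw [Category.assoc, IsIso.hom_inv_id, Category.comp_id]
    rw [e]; infer_instance
  exact epi_of_epi_fac (homologyπ_naturality φ n)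

/-- An object `X` with cohomology in degrees `≤ n` is covered by `P[-n]` for some `P`, with
a cone having cohomology in degrees `< n`. -/
lemma exists_singleFunctor_cone_isLE {ι : Type*} (P : ι → A)
    (hP : ∀ M : A, ∃ (c : ι) (π : P c ⟶ M), Epi π) (n m : ℤ) (hm : m + 1 = n)
    (X : DerivedCategory A) [t.IsLE X n] :
    ∃ (c : ι) (f : (singleFunctor A n).obj (P c) ⟶ X) (Y : DerivedCategory A) (g : X ⟶ Y)
      (h : Y ⟶ ((singleFunctor A n).obj (P c))⟦(1 : ℤ)⟧),
      Triangle.mk f g h ∈ distTriang _ ∧ t.IsLE Y m := by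
  -- In a model vanishing above degree n, a cover of the last term is automatically a chain map from
  -- P[-n].
  obtain ⟨K, hK, ⟨e⟩⟩ := exists_iso_Q_obj_of_isLE X n
  obtain ⟨c, π, _⟩ := hP (K.X n)
  let φ : (HomologicalComplex.single A (.up ℤ) n).obj (P c) ⟶ K :=
    mkHomFromSingle π fun k hk =>
      (K.isZero_of_isStrictlyLE n k (by simp at hk; lia)).eq_of_tgt _ _
  have : Epi (φ.f n) := by
    rw [mkHomFromSingle_f]; infer_instance
  have : Epi (homologyMap φ n) := epi_homologyMap_of_epi_f φ n
  let f : (singleFunctor A n).obj (P c) ⟶ X := Q.map φ ≫ e.inv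
  obtain ⟨Y, g, h, hT⟩ := distinguished_cocone_triangle f
  refine ⟨c, f, Y, g, h, hT, (isLE_iff Y m).2 fun i hi => ?_⟩
  have : Epi ((homologyFunctor A n).map f) := by
    have h₁ : Epi ((Q ⋙ homologyFunctor A n).map φ) := by
      rw [← NatIso.naturality_2 (homologyFunctorFactors A n) φ]
      have : Epi ((HomologicalComplex.homologyFunctor A (.up ℤ) n).map φ) := this
      infer_instance
    have h₁ : Epi ((homologyFunctor A n).map (Q.map φ)) := h₁
    have h₂ : (homologyFunctor A n).map f =
        (homologyFunctor A n).map (Q.map φ) ≫ (homologyFunctor A n).map e.inv :=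
      Functor.map_comp _ _ _
    rw [h₂]
    exact @epi_comp _ _ _ _ _ _ h₁ ((homologyFunctor A n).map e.inv) inferInstance
  -- Here i ≥ n. H^i(g) is onto since H^(i+1)(P[-n]) = 0; it is zero for i = n because H^n(f) is
  -- onto, and for i > n because H^i(X) = 0.
  have h₁ : Epi ((homologyFunctor A i).map g) := by
    refine (HomologySequence.epi_homologyMap_mor₂_iff _ hT i (i + 1)).2 ?_
    exact (isZero_of_isLE ((singleFunctor A n).obj (P c)) n (i + 1) (by lia)).eq_of_tgt _ _
  refine IsZero.of_epi_eq_zero ((homologyFunctor A i).map g) ?_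
  obtain rfl | hi' := eq_or_ne i n
  · exact (HomologySequence.epi_homologyMap_mor₁_iff _ hT i).1 ‹_›
  · exact (isZero_of_isLE X n i (by lia)).eq_of_src _ _

end

end Derived

section DerivedLinear

open DerivedCategory DerivedCategory.TStructure Pretriangulated Triangulated Abelian

/-! ### Objects generated by short exact sequences -/

section

variable {A : Type u} [Category.{v} A] [Abelian A] [HasDerivedCategory.{w} A]

lemma prop_single_X₃ (Q : ObjectProperty (DerivedCategory A)) [Q.IsClosedUnderIsomorphisms]
    [Q.IsTriangulated] {S : ShortComplex A} (hS : S.ShortExact)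
    (h₁ : Q ((singleFunctor A 0).obj S.X₁)) (h₂ : Q ((singleFunctor A 0).obj S.X₂)) :
    Q ((singleFunctor A 0).obj S.X₃) :=
  Q.ext_of_isTriangulatedClosed₃ _ hS.singleTriangle_distinguished h₁ h₂

lemma prop_single_X₁ (Q : ObjectProperty (DerivedCategory A)) [Q.IsClosedUnderIsomorphisms]
    [Q.IsTriangulated] {S : ShortComplex A} (hS : S.ShortExact)
    (h₂ : Q ((singleFunctor A 0).obj S.X₂)) (h₃ : Q ((singleFunctor A 0).obj S.X₃)) :
    Q ((singleFunctor A 0).obj S.X₁) :=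
  Q.ext_of_isTriangulatedClosed₁ _ hS.singleTriangle_distinguished h₂ h₃

lemma bounded_le_of_single (Q : ObjectProperty (DerivedCategory A)) [Q.IsClosedUnderIsomorphisms]
    [Q.IsTriangulated] (h : ∀ M, Q ((singleFunctor A 0).obj M)) :
    (t : TStructure (DerivedCategory A)).bounded ≤ Q := fun X hX =>
  prop_of_bounded Q (fun n M => Q.prop_of_iso
    (((singleFunctors A).shiftIso (-n) n 0 (by simp)).app M) (Q.le_shift (-n) _ (h M))) hX

end

/-! ### Finite dimensional morphism spaces -/

variable (k : Type w') [Field k]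

lemma finite_of_exact {V₁ V₂ V₃ : Type*} [AddCommGroup V₁] [AddCommGroup V₂] [AddCommGroup V₃]
    [Module k V₁] [Module k V₂] [Module k V₃] [Module.Finite k V₁] [Module.Finite k V₃]
    (f : V₁ →ₗ[k] V₂) (g : V₂ →ₗ[k] V₃) (h : ∀ x, g x = 0 → ∃ y, f y = x) :
    Module.Finite k V₂ := by
  have : Module.Finite k g.ker := by
    refine Submodule.finiteDimensional_of_le (S₂ := f.range) ?_
    intro x hx
    exact h x hx
  have : Module.Finite k (V₂ ⧸ g.ker) := Module.Finite.equiv g.quotKerEquivRange.symm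
  exact Module.Finite.of_submodule_quotient g.ker

section

variable {T : Type u} [Category.{v} T] [Preadditive T] [Linear k T]
  [HasShift T ℤ] [HasZeroObject T] [∀ n : ℤ, (shiftFunctor T n).Additive]
  [∀ n : ℤ, (shiftFunctor T n).Linear k] [Pretriangulated T]

/-- The objects `Y` for which `Hom(X, Y)` is finite dimensional. -/
def finiteFrom (X : T) : ObjectProperty T := fun Y => Module.Finite k (X ⟶ Y)

instance (X : T) : (finiteFrom k X).IsClosedUnderIsomorphisms where
  of_iso e (_ : Module.Finite k _) := Module.Finite.equiv (Linear.homCongr k (Iso.refl X) e)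

instance (X : T) : (finiteFrom k X).IsTriangulatedClosed₂ :=
  .mk' fun S hS (_ : Module.Finite k _) (_ : Module.Finite k _) =>
    finite_of_exact k (Linear.rightComp k X S.mor₁) (Linear.rightComp k X S.mor₂)
      fun x hx => let ⟨y, hy⟩ := Triangle.coyoneda_exact₂ _ hS x hx; ⟨y, hy.symm⟩

/-- The objects `X` for which `Hom(X, Y)` is finite dimensional for all `Y` in `Q`. -/
def finiteTo (Q : ObjectProperty T) : ObjectProperty T :=
  fun X => ∀ Y, Q Y → Module.Finite k (X ⟶ Y)

instance (Q : ObjectProperty T) : (finiteTo k Q).IsClosedUnderIsomorphisms where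
  of_iso e h Y hY :=
    have := h Y hY
    Module.Finite.equiv (Linear.homCongr k e (Iso.refl Y))

instance (Q : ObjectProperty T) [Q.IsStableUnderShift ℤ] : (finiteTo k Q).IsTriangulated where
  exists_zero := ⟨_, isZero_zero T, fun Y _ =>
    have : Subsingleton ((HasZeroObject.zero' T).zero ⟶ Y) :=
      ⟨fun f g => (isZero_zero T).eq_of_src f g⟩
    inferInstance⟩
  isStableUnderShiftBy n :=
    { le_shift := fun X hX Y hY => by
        have := hX _ (Q.le_shift (-n) _ hY)
        have e : (X ⟶ Y⟦-n⟧) ≃ₗ[k] (X⟦n⟧ ⟶ (Y⟦-n⟧)⟦n⟧) :=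
          LinearEquiv.ofBijective ((shiftFunctor T n).mapLinearMap k)
            ⟨(shiftFunctor T n).map_injective, (shiftFunctor T n).map_surjective⟩
        exact Module.Finite.equiv (e.trans (Linear.homCongr k (Iso.refl _)
          ((shiftEquiv T n).counitIso.app Y))) }
  toIsTriangulatedClosed₂ := .mk' fun S hS h₁ h₃ Y hY => by
    have := h₁ Y hY
    have := h₃ Y hY
    exact finite_of_exact k (Linear.leftComp k Y S.mor₂) (Linear.leftComp k Y S.mor₁)
      fun x hx => let ⟨y, hy⟩ := Triangle.yoneda_exact₂ _ hS x hx; ⟨y, hy.symm⟩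

end

variable {A : Type u} [Category.{v} A] [Abelian A] [HasDerivedCategory.{w} A] [Linear k A]

/-- `singleFunctor A n` is fully faithful and linear. -/
noncomputable def singleHomEquiv (n : ℤ) (M N : A) :
    (M ⟶ N) ≃ₗ[k] ((singleFunctor A n).obj M ⟶ (singleFunctor A n).obj N) :=
  LinearEquiv.ofBijective ((singleFunctor A n).mapLinearMap k)
    ⟨(singleFunctor A n).map_injective, (singleFunctor A n).map_surjective⟩

@[simp] lemma singleHomEquiv_apply (n : ℤ) {M N : A} (f : M ⟶ N) :
    singleHomEquiv k n M N f = (singleFunctor A n).map f := rfl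

/-- From a projective in degree 0 only the degree 0 part of the target receives nonzero maps, and
these are computed in A; resolutions then handle every source. -/
lemma finite_hom_of_resolutions (hA : ∀ M N : A, Module.Finite k (M ⟶ N))
    (hP : ∀ M : A, ∃ (S : ShortComplex A), S.ShortExact ∧ S.X₃ = M ∧ Projective S.X₁ ∧
      Projective S.X₂) {X Y : DerivedCategory A} (hX : t.bounded X) (hY : t.bounded Y) :
    Module.Finite k (X ⟶ Y) := by
  have proj (P : A) [Projective P] : finiteTo k t.bounded ((singleFunctor A 0).obj P) := by
    intro Y hY
    refine prop_of_bounded (finiteFrom k ((singleFunctor A 0).obj P)) (fun n M => ?_) hY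
    change Module.Finite k _
    obtain h | rfl | h := lt_trichotomy n 0
    · have : Subsingleton ((singleFunctor A 0).obj P ⟶ (singleFunctor A n).obj M) :=
        subsingleton_of_forall_eq 0 fun f =>
          hom_eq_zero_of_isLE 1 0 n (by lia) (bounded_single n M) f
      infer_instance
    · exact Module.Finite.equiv (singleHomEquiv k 0 P M)
    · have : Subsingleton ((singleFunctor A 0).obj P ⟶ (singleFunctor A n).obj M) :=
        subsingleton_of_forall_eq 0 fun f => t.zero f 0 n
      infer_instance
  refine bounded_le_of_single (finiteTo k t.bounded) (fun M => ?_) X hX Y hY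
  obtain ⟨S, hS, rfl, _, _⟩ := hP M
  exact prop_single_X₃ _ hS (proj _) (proj _)

/-! ### Serre pairs given by projectives and injectives -/

omit [Linear k A] in
lemma exists_truncation {Y : DerivedCategory A} (hY : t.bounded Y) (m n : ℤ) (hmn : m + 1 = n) :
    ∃ (Y₀ Y₁ : DerivedCategory A) (f : Y₀ ⟶ Y) (g : Y ⟶ Y₁) (h : Y₁ ⟶ Y₀⟦(1 : ℤ)⟧),
      Triangle.mk f g h ∈ distTriang _ ∧ t.bounded Y₀ ∧ t.bounded Y₁ ∧ t.IsLE Y₀ m ∧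
      t.IsGE Y₁ n ∧ (∀ i, t.IsLE Y i → t.IsLE Y₁ i) := by
  obtain ⟨⟨a, _⟩, ⟨b, _⟩⟩ := hY
  refine ⟨(t.truncLT n).obj Y, (t.truncGE n).obj Y, _, _, _, t.triangleLTGE_distinguished n Y,
    ⟨⟨a, inferInstance⟩, ⟨m, t.isLE_truncLT_obj _ _ _⟩⟩, ⟨⟨n, inferInstance⟩, ⟨b, inferInstance⟩⟩,
    t.isLE_truncLT_obj _ _ _, inferInstance, fun i _ => inferInstance⟩

section

variable {k}
variable {P I : A} [Projective P] [Injective I] (p : SerrePair k P I)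

/-- The trace of a Serre pair in the heart, as a functional on morphisms of the derived
category. -/
noncomputable def SerrePair.singleTrace :
    ((singleFunctor A 0).obj P ⟶ (singleFunctor A 0).obj I) →ₗ[k] k :=
  p.t ∘ₗ (singleHomEquiv k 0 P I).symm.toLinearMap

omit [Projective P] [Injective I] in
lemma SerrePair.singleTrace_map (f : P ⟶ I) :
    p.singleTrace ((singleFunctor A 0).map f) = p.t f :=
  congrArg p.t ((singleHomEquiv k 0 P I).symm_apply_apply f)

omit [Linear k A] [Field k] in
/-- Both `Hom(P, Y)` and `Hom(Y, I)` only depend on the cohomology of `Y` in degree zero, if `P` is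
projective and `I` is injective. -/
lemma exists_roof (P I : A) [Projective P] [Injective I] {Y : DerivedCategory A}
    (hY : t.bounded Y) :
    ∃ (Y₀ : DerivedCategory A) (M : A) (f : Y₀ ⟶ Y) (π : Y₀ ⟶ (singleFunctor A 0).obj M),
      (∀ x : (singleFunctor A 0).obj P ⟶ Y, ∃ x', x' ≫ f = x) ∧
      (∀ z : Y ⟶ (singleFunctor A 0).obj I, f ≫ z = 0 → z = 0) ∧
      (∀ y : Y₀ ⟶ (singleFunctor A 0).obj I, ∃ z, f ≫ z = y) ∧
      (∀ x : (singleFunctor A 0).obj P ⟶ (singleFunctor A 0).obj M, ∃ x', x' ≫ π = x) ∧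
      (∀ x : (singleFunctor A 0).obj P ⟶ Y₀, x ≫ π = 0 → x = 0) ∧
      (∀ y : Y₀ ⟶ (singleFunctor A 0).obj I, ∃ z, π ≫ z = y) := by
  -- The roof is Y ← τ≤0 Y → H⁰(Y); each clause is one vanishing term in a long exact Hom sequence.
  obtain ⟨Y₀, Y₁, f, g, h, hT, hY₀, hY₁, _, _, -⟩ := exists_truncation hY 0 1 (by simp)
  obtain ⟨Y₂, N, i, π, δ, hT', hY₂, hN, _, _, hN'⟩ := exists_truncation hY₀ (-1) 0 (by simp)
  have := hN' 0 inferInstance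
  obtain ⟨M, ⟨e⟩⟩ := exists_iso_singleFunctor_obj_of_isGE_of_isLE N 0
  have hY₂' : t.bounded (Y₂⟦(1 : ℤ)⟧) := t.bounded.le_shift 1 _ hY₂
  have := t.isLE_shift Y₂ (-1) 1 (-2)
  have := t.isGE_shift Y₁ 1 (-1) 2
  have hY₁' : t.bounded (Y₁⟦(-1 : ℤ)⟧) := t.bounded.le_shift (-1) _ hY₁
  refine ⟨Y₀, M, f, π ≫ e.hom, fun x => ?_, fun z hz => ?_, fun y => ?_, fun x => ?_,
    fun x hx => ?_, fun y => ?_⟩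
  · obtain ⟨x', rfl⟩ := distTriang_coyoneda₂ hT x (t.zero _ 0 1)
    exact ⟨x', rfl⟩
  · obtain ⟨z', rfl⟩ := distTriang_yoneda₂ hT z hz
    rw [hom_eq_zero_of_isGE 1 1 0 (by simp) hY₁ z', comp_zero]
  · obtain ⟨z, hz⟩ := Triangle.yoneda_exact₂ _ (inv_rot_of_distTriang _ hT) y
      (hom_eq_zero_of_isGE 1 2 0 (by simp) hY₁' _)
    exact ⟨z, hz.symm⟩
  · obtain ⟨x', hx'⟩ := distTriang_coyoneda₃ hT' (x ≫ e.inv)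
      (hom_eq_zero_of_isLE 1 0 (-2) (by simp) hY₂' _)
    exact ⟨x', by rw [← Category.assoc, ← hx', Category.assoc, e.inv_hom_id, Category.comp_id]⟩
  · obtain ⟨x', rfl⟩ := distTriang_coyoneda₂ hT' x (by
      rw [← cancel_mono e.hom, Category.assoc, hx, zero_comp])
    rw [hom_eq_zero_of_isLE 1 0 (-1) (by simp) hY₂ x', zero_comp]
  · obtain ⟨z, rfl⟩ := distTriang_yoneda₂ hT' y (t.zero _ (-1) 0)
    exact ⟨e.inv ≫ z, by simp⟩

/-- Along the roof, `x` becomes a map P → M in the heart, and every test map M → I comes from one on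
`Y`, so nondegeneracy in the heart applies. -/
lemma SerrePair.singleTrace_left {Y : DerivedCategory A}
    (hY : DerivedCategory.TStructure.t.bounded Y)
    (x : (singleFunctor A 0).obj P ⟶ Y) (hx : ∀ z, p.singleTrace (x ≫ z) = 0) : x = 0 := by
  obtain ⟨Y₀, M, f, π, h₁, h₂, h₃, h₄, h₅, h₆⟩ := exists_roof P I hY
  obtain ⟨x, rfl⟩ := h₁ x
  obtain ⟨x₀, hx₀⟩ := (singleFunctor A 0).map_surjective (x ≫ π)
  have : x₀ = 0 := p.left _ fun z => by
    obtain ⟨z', hz'⟩ := h₃ (π ≫ (singleFunctor A 0).map z)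
    have := hx z'
    rwa [Category.assoc, hz', ← Category.assoc, ← hx₀, ← Functor.map_comp,
      p.singleTrace_map] at this
  rw [h₅ x (by rw [← hx₀, this, Functor.map_zero]), zero_comp]

lemma SerrePair.singleTrace_right {Y : DerivedCategory A}
    (hY : DerivedCategory.TStructure.t.bounded Y)
    (z : Y ⟶ (singleFunctor A 0).obj I) (hz : ∀ x, p.singleTrace (x ≫ z) = 0) : z = 0 := by
  obtain ⟨Y₀, M, f, π, h₁, h₂, h₃, h₄, h₅, h₆⟩ := exists_roof P I hY
  obtain ⟨z', hz'⟩ := h₆ (f ≫ z)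
  obtain ⟨z₀, rfl⟩ := (singleFunctor A 0).map_surjective z'
  have : z₀ = 0 := p.right _ fun x => by
    obtain ⟨x', hx'⟩ := h₄ ((singleFunctor A 0).map x)
    have := hz (x' ≫ f)
    rwa [Category.assoc, ← hz', ← Category.assoc, hx', ← Functor.map_comp,
      p.singleTrace_map] at this
  exact h₂ z (by rw [← hz', this, Functor.map_zero, comp_zero])

/-- A Serre pair in the heart consisting of a projective and an injective object is a Serre pair
in the bounded derived category. -/
noncomputable def SerrePair.single :
    SerrePair k (C := BoundedDerivedCategory A) ⟨(singleFunctor A 0).obj P, bounded_single 0 P⟩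
      ⟨(singleFunctor A 0).obj I, bounded_single 0 I⟩ where
  t :=
    { toFun := fun f => p.singleTrace f.hom
      map_add' := fun f g => map_add p.singleTrace f.hom g.hom
      map_smul' := fun a f => map_smul p.singleTrace a f.hom }
  left {Y} x hx := ObjectProperty.hom_ext _
    (p.singleTrace_left Y.property x.hom fun z => hx (ObjectProperty.homMk z))
  right {Y} z hz := ObjectProperty.hom_ext _
    (p.singleTrace_right Y.property z.hom fun x => hz (ObjectProperty.homMk x))

end

/-! ### Serre duality from projective and injective resolutions -/

section

variable {T : Type u} [Category.{v} T] [Preadditive T] [Linear k T] [HasShift T ℤ]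
  [∀ n : ℤ, (shiftFunctor T n).Additive] [∀ n : ℤ, (shiftFunctor T n).Linear k]
  [HasZeroObject T] [Pretriangulated T] [∀ X Y : T, Module.Finite k (X ⟶ Y)]

omit [HasShift T ℤ] [∀ n : ℤ, (shiftFunctor T n).Additive] [∀ n : ℤ, (shiftFunctor T n).Linear k]
  [HasZeroObject T] [Pretriangulated T] [∀ X Y : T, Module.Finite k (X ⟶ Y)] in
lemma SerrePair.nonempty_of_isZero {Z : T} (hZ : IsZero Z) : Nonempty (SerrePair k Z Z) :=
  ⟨{ t := 0, left := fun _ _ => hZ.eq_of_src _ _, right := fun _ _ => hZ.eq_of_tgt _ _ }⟩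

instance : (serreLeft k T).IsTriangulated where
  exists_zero := ⟨_, isZero_zero T, _, SerrePair.nonempty_of_isZero k (isZero_zero T)⟩
  isStableUnderShiftBy n := ⟨fun _ hX => serreLeft_shift n hX⟩

instance : (serreRight k T).IsTriangulated where
  exists_zero := ⟨_, isZero_zero T, _, SerrePair.nonempty_of_isZero k (isZero_zero T)⟩
  isStableUnderShiftBy n := ⟨fun _ hX => serreRight_shift n hX⟩

end

/-- Checked in the derived category: the inclusion is faithful, linear and commutes with shifts. -/
instance (n : ℤ) : (shiftFunctor (BoundedDerivedCategory A) n).Linear k where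
  map_smul {X Y} f r := by
    let ι := ObjectProperty.ι (TStructure.t (C := A)).bounded
    let e := ι.commShiftIso n
    have he {X Y : BoundedDerivedCategory A} (f : X ⟶ Y) : ι.map (f⟦n⟧') =
        e.hom.app X ≫ (shiftFunctor (DerivedCategory A) n).map (ι.map f) ≫ e.inv.app Y :=
      (NatIso.naturality_2 e f).symm
    apply ι.map_injective
    have h₁ : ι.map (r • f) = r • ι.map f := rfl
    have h₂ : ι.map (r • f⟦n⟧') = r • ι.map (f⟦n⟧') := rfl
    rw [h₂, he, he, h₁, Functor.map_smul, Linear.smul_comp, Linear.comp_smul]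

lemma prop_of_bounded_le (Q : ObjectProperty (BoundedDerivedCategory A))
    [Q.IsClosedUnderIsomorphisms] [Q.IsTriangulated]
    (h : ∀ M, Q ⟨(singleFunctor A 0).obj M, bounded_single 0 M⟩) (X : BoundedDerivedCategory A) :
    Q X := by
  obtain ⟨Y, hY, ⟨e⟩⟩ := bounded_le_of_single (Q.map (ObjectProperty.ι _))
    (fun M => ⟨_, h M, ⟨Iso.refl _⟩⟩) X.obj X.property
  exact Q.prop_of_iso ((ObjectProperty.ι _).preimageIso e) hY

/-- An abelian category, in which every object has a projective resolution of length one by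
projective objects having a Serre dual, and dually, satisfies Serre duality. -/
theorem hasSerreDuality_boundedDerivedCategory (hA : ∀ M N : A, Module.Finite k (M ⟶ N))
    (hP : ∀ M : A, ∃ S : ShortComplex A, S.ShortExact ∧ S.X₃ = M ∧
      (Projective S.X₁ ∧ ∃ I, Injective I ∧ Nonempty (SerrePair k S.X₁ I)) ∧
      (Projective S.X₂ ∧ ∃ I, Injective I ∧ Nonempty (SerrePair k S.X₂ I)))
    (hI : ∀ M : A, ∃ S : ShortComplex A, S.ShortExact ∧ S.X₁ = M ∧
      (Injective S.X₂ ∧ ∃ P, Projective P ∧ Nonempty (SerrePair k P S.X₂)) ∧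
      (Injective S.X₃ ∧ ∃ P, Projective P ∧ Nonempty (SerrePair k P S.X₃))) :
    HasSerreDuality k (BoundedDerivedCategory A) := by
  have (X Y : BoundedDerivedCategory A) : Module.Finite k (X ⟶ Y) := by
    have : Module.Finite k (X.obj ⟶ Y.obj) := finite_hom_of_resolutions k hA (fun M => by
      obtain ⟨S, hS, hS', h₁, h₂⟩ := hP M
      exact ⟨S, hS, hS', h₁.1, h₂.1⟩) X.property Y.property
    exact Module.Finite.of_injective (M := X ⟶ Y) (N := X.obj ⟶ Y.obj)
      ((ObjectProperty.ι (TStructure.t (C := A)).bounded).mapLinearMap k)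
      (ObjectProperty.ι _).map_injective
  refine hasSerreDuality_of_serrePairs (prop_of_bounded_le (serreLeft k _) fun M => ?_)
    (prop_of_bounded_le (serreRight k _) fun M => ?_)
  · obtain ⟨S, hS, rfl, ⟨_, I₁, _, ⟨p₁⟩⟩, ⟨_, I₂, _, ⟨p₂⟩⟩⟩ := hP M
    have h₁ : serreLeft k (BoundedDerivedCategory A) _ := ⟨_, ⟨p₁.single⟩⟩
    have h₂ : serreLeft k (BoundedDerivedCategory A) _ := ⟨_, ⟨p₂.single⟩⟩
    obtain ⟨Y, hY, ⟨e⟩⟩ := prop_single_X₃ ((serreLeft k (BoundedDerivedCategory A)).map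
      (ObjectProperty.ι _)) hS ⟨_, h₁, ⟨Iso.refl _⟩⟩ ⟨_, h₂, ⟨Iso.refl _⟩⟩
    exact (serreLeft k _).prop_of_iso ((ObjectProperty.ι _).preimageIso e) hY
  · obtain ⟨S, hS, rfl, ⟨_, P₂, _, ⟨p₂⟩⟩, ⟨_, P₃, _, ⟨p₃⟩⟩⟩ := hI M
    have h₂ : serreRight k (BoundedDerivedCategory A) _ := ⟨_, ⟨p₂.single⟩⟩
    have h₃ : serreRight k (BoundedDerivedCategory A) _ := ⟨_, ⟨p₃.single⟩⟩
    obtain ⟨Y, hY, ⟨e⟩⟩ := prop_single_X₁ ((serreRight k (BoundedDerivedCategory A)).map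
      (ObjectProperty.ι _)) hS ⟨_, h₂, ⟨Iso.refl _⟩⟩ ⟨_, h₃, ⟨Iso.refl _⟩⟩
    exact (serreRight k _).prop_of_iso ((ObjectProperty.ι _).preimageIso e) hY

end DerivedLinear

/-! ### Serre pairs from a Serre functor -/

section SerreFunctor

variable {k : Type w} [Field k] {C : Type u} [Category.{v} C] [Preadditive C] [Linear k C]

/-- The Serre pair given by a Serre functor. -/
def SerreFunctor.serrePair (F : SerreFunctor k C) (X : C) : SerrePair k X (F.S.functor.obj X) :=
  have h {Y : C} (x : X ⟶ Y) (z : Y ⟶ F.S.functor.obj X) :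
      F.iso X X (𝟙 X) (x ≫ z) = F.iso X Y x z := by
    rw [← F.iso_naturality_right, Category.id_comp]
  { t := F.iso X X (𝟙 X)
    left := fun {Y} x hx => (F.iso X Y).map_eq_zero_iff.1
      (LinearMap.ext fun z => (h x z).symm.trans (hx z))
    -- Every functional on Hom(Y, S X) is the pairing with some x, and functionals separate vectors.
    right := fun {Y} z hz => (Module.forall_dual_apply_eq_zero_iff k z).1 fun φ => by
      rw [← (F.iso X Y).apply_symm_apply φ, ← h, hz] }

lemma exists_serrePair_left (h : HasSerreDuality k C) (X : C) : ∃ Z, Nonempty (SerrePair k X Z) :=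
  let ⟨_, ⟨F⟩⟩ := h
  ⟨_, ⟨F.serrePair X⟩⟩

lemma exists_serrePair_right (h : HasSerreDuality k C) (Z : C) :
    ∃ X, Nonempty (SerrePair k X Z) :=
  let ⟨_, ⟨F⟩⟩ := h
  ⟨_, ⟨(F.serrePair _).ofIso (Iso.refl _) (F.S.functor.objObjPreimageIso Z)⟩⟩

end SerreFunctor

/-! ### Consequences of Serre duality for projective objects -/

section DerivedLinear

open DerivedCategory DerivedCategory.TStructure Pretriangulated Triangulated Abelian

variable (k : Type w') [Field k]
variable {A : Type u} [Category.{v} A] [Abelian A] [HasDerivedCategory.{w} A] [Linear k A]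

/-- Morphisms from projective objects to a bounded complex are morphisms to its cohomology in
degree zero. -/
lemma exists_projective_hom_equiv {Y : DerivedCategory A} (hY : t.bounded Y) :
    ∃ (N : A) (φ : ∀ (Q : A) [Projective Q], (Q ⟶ N) ≃ₗ[k] ((singleFunctor A 0).obj Q ⟶ Y)),
      ∀ (Q Q' : A) [Projective Q] [Projective Q'] (x : Q ⟶ Q') (z : Q' ⟶ N),
        φ Q (x ≫ z) = (singleFunctor A 0).map x ≫ φ Q' z := by
  obtain ⟨Y₀, Y₁, f, g, h, hT, hY₀, hY₁, _, _, -⟩ := exists_truncation hY 0 1 (by simp)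
  obtain ⟨Y₂, N, i, π, δ, hT', hY₂, hN, _, _, hN'⟩ := exists_truncation hY₀ (-1) 0 (by simp)
  have := hN' 0 inferInstance
  obtain ⟨M, ⟨e⟩⟩ := exists_iso_singleFunctor_obj_of_isGE_of_isLE N 0
  have hY₂' : t.bounded (Y₂⟦(1 : ℤ)⟧) := t.bounded.le_shift 1 _ hY₂
  have := t.isLE_shift Y₂ (-1) 1 (-2)
  have := t.isGE_shift Y₁ 1 (-1) 2
  -- For τ≤0 Y → Y the obstructions are Hom(Q, Y₁[-1]) and Hom(Q, Y₁), where Y₁ lives in degrees ≥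
  -- 1.
  have b₁ (Q : A) [Projective Q] :
      Function.Bijective (Linear.rightComp k ((singleFunctor A 0).obj Q) f) := by
    refine ⟨(injective_iff_map_eq_zero _).2 fun x hx => ?_, fun x => ?_⟩
    · obtain ⟨w, x', rfl⟩ : ∃ (w : Y₁⟦(-1 : ℤ)⟧ ⟶ Y₀) (x' : _ ⟶ Y₁⟦(-1 : ℤ)⟧), x = x' ≫ w :=
        ⟨_, distTriang_coyoneda₂ (inv_rot_of_distTriang _ hT) x hx⟩
      rw [t.zero x' 0 2, zero_comp]
    · obtain ⟨x', rfl⟩ := distTriang_coyoneda₂ hT x (t.zero _ 0 1)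
      exact ⟨x', rfl⟩
  -- For τ≤0 Y → H⁰(Y) the obstructions are Hom(Q, Y₂) and Hom(Q, Y₂[1]), where Y₂ lives in degrees
  -- ≤ -1; projectivity of Q kills both.
  have b₂ (Q : A) [Projective Q] :
      Function.Bijective (Linear.rightComp k ((singleFunctor A 0).obj Q) π) := by
    refine ⟨(injective_iff_map_eq_zero _).2 fun x hx => ?_, fun x => ?_⟩
    · obtain ⟨x', rfl⟩ := distTriang_coyoneda₂ hT' x hx
      rw [hom_eq_zero_of_isLE 1 0 (-1) (by simp) hY₂ x', zero_comp]
    · obtain ⟨x', rfl⟩ := distTriang_coyoneda₃ hT' x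
        (hom_eq_zero_of_isLE 1 0 (-2) (by simp) hY₂' _)
      exact ⟨x', rfl⟩
  let φ (Q : A) [Projective Q] : (Q ⟶ M) ≃ₗ[k] ((singleFunctor A 0).obj Q ⟶ Y) :=
    singleHomEquiv k 0 Q M ≪≫ₗ Linear.homCongr k (Iso.refl _) e.symm ≪≫ₗ
      (LinearEquiv.ofBijective _ (b₂ Q)).symm ≪≫ₗ LinearEquiv.ofBijective _ (b₁ Q)
  refine ⟨M, φ, fun Q Q' _ _ x z => ?_⟩
  have h₁ (Q : A) [Projective Q] (z : Q ⟶ M) :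
      ∃ y, y ≫ π = (singleFunctor A 0).map z ≫ e.inv ∧ y ≫ f = φ Q z :=
    ⟨(LinearEquiv.ofBijective _ (b₂ Q)).symm ((singleFunctor A 0).map z ≫ e.inv),
      (LinearEquiv.ofBijective _ (b₂ Q)).apply_symm_apply _, congrArg
      (fun w => (LinearEquiv.ofBijective _ (b₂ Q)).symm w ≫ f) (by simp [Linear.homCongr_apply])⟩
  obtain ⟨y, hy, hy'⟩ := h₁ Q (x ≫ z)
  obtain ⟨y₁, hy₁, hy₁'⟩ := h₁ Q' z
  have : y = (singleFunctor A 0).map x ≫ y₁ := (b₂ Q).1 (by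
    change y ≫ π = ((singleFunctor A 0).map x ≫ y₁) ≫ π
    rw [hy, Category.assoc, hy₁, Functor.map_comp, Category.assoc])
  rw [← hy', ← hy₁', this, Category.assoc]

/-- If Serre duality holds, then the functor `Hom(P, -)^*` is representable on the category of
projective objects for each projective object `P`. -/
theorem exists_trace_of_projective (hS : HasSerreDuality k (BoundedDerivedCategory A))
    (P : A) [Projective P] :
    ∃ (N : A) (τ : (P ⟶ N) →ₗ[k] k), ∀ (Q : A) [Projective Q],
      (∀ x : P ⟶ Q, (∀ z : Q ⟶ N, τ (x ≫ z) = 0) → x = 0) ∧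
      (∀ z : Q ⟶ N, (∀ x : P ⟶ Q, τ (x ≫ z) = 0) → z = 0) := by
  obtain ⟨W, ⟨p⟩⟩ := exists_serrePair_left hS ⟨(singleFunctor A 0).obj P, bounded_single 0 P⟩
  -- The partner `W` may be a genuine complex; H⁰(W) suffices because only maps from projectives are
  -- tested.
  obtain ⟨N, φ, hφ⟩ := exists_projective_hom_equiv k W.property
  let τ : (P ⟶ N) →ₗ[k] k :=
    { toFun := fun z => p.t (ObjectProperty.homMk (φ P z))
      map_add' := fun y z => by rw [map_add]; exact map_add p.t _ _
      map_smul' := fun a z => by rw [map_smul]; exact map_smul p.t _ _ }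
  have hτ (Q : A) [Projective Q] (x : P ⟶ Q) (z : Q ⟶ N) : τ (x ≫ z) = p.t
      (ObjectProperty.homMk (Y := ⟨(singleFunctor A 0).obj Q, bounded_single 0 Q⟩)
        ((singleFunctor A 0).map x) ≫ ObjectProperty.homMk (φ Q z)) :=
    congrArg (fun f => p.t (ObjectProperty.homMk f)) (hφ P Q x z)
  refine ⟨N, τ, fun Q _ => ⟨fun x hx => ?_, fun z hz => ?_⟩⟩
  · refine (singleFunctor A 0).map_injective (Eq.trans ?_ (Functor.map_zero _ _ _).symm)
    have := p.left (Y := ⟨(singleFunctor A 0).obj Q, bounded_single 0 Q⟩)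
      (ObjectProperty.homMk ((singleFunctor A 0).map x)) fun z => by
        rw [← hx ((φ Q).symm z.hom), hτ, LinearEquiv.apply_symm_apply]
        rfl
    exact congrArg (fun f => f.hom) this
  · refine (φ Q).map_eq_zero_iff.1 (congrArg InducedCategory.Hom.hom (p.right
      (Y := ⟨(singleFunctor A 0).obj Q, bounded_single 0 Q⟩)
      (ObjectProperty.homMk (φ Q z)) fun x => ?_))
    obtain ⟨x', hx'⟩ := (singleFunctor A 0).map_surjective x.hom
    rw [← hz x', hτ, hx']
    rfl

-- The cohomology of a retract is a retract of the cohomology.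
omit [Linear k A] [Field k] in
lemma isLE_of_retract {X Y : DerivedCategory A} (i : X ⟶ Y) (r : Y ⟶ X) (h : i ≫ r = 𝟙 X) (n : ℤ)
    [t.IsLE Y n] : t.IsLE X n := by
  refine (isLE_iff X n).2 fun j hj => (IsZero.iff_id_eq_zero _).2 ?_
  rw [← CategoryTheory.Functor.map_id, ← h, Functor.map_comp, (isZero_of_isLE Y n j hj).eq_of_tgt
    ((homologyFunctor A j).map i) 0, zero_comp]

omit [Linear k A] [Field k] in
lemma isGE_of_retract {X Y : DerivedCategory A} (i : X ⟶ Y) (r : Y ⟶ X) (h : i ≫ r = 𝟙 X) (n : ℤ)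
    [t.IsGE Y n] : t.IsGE X n := by
  refine (isGE_iff X n).2 fun j hj => (IsZero.iff_id_eq_zero _).2 ?_
  rw [← CategoryTheory.Functor.map_id, ← h, Functor.map_comp, (isZero_of_isGE Y n j hj).eq_of_tgt
    ((homologyFunctor A j).map i) 0, zero_comp]

omit [Linear k A] [Field k] in
/-- A retract of an object of the heart lies in the heart. -/
lemma exists_iso_single_of_retract {Y : DerivedCategory A} {M : A}
    (i : Y ⟶ (singleFunctor A 0).obj M) (r : (singleFunctor A 0).obj M ⟶ Y) (h : i ≫ r = 𝟙 Y) :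
    ∃ (N : A) (_ : (singleFunctor A 0).obj N ≅ Y) (i' : N ⟶ M) (r' : M ⟶ N), i' ≫ r' = 𝟙 N := by
  have := isLE_of_retract i r h 0
  have := isGE_of_retract i r h 0
  obtain ⟨N, ⟨e⟩⟩ := exists_iso_singleFunctor_obj_of_isGE_of_isLE Y 0
  obtain ⟨i', hi'⟩ := (singleFunctor A 0).map_surjective (e.inv ≫ i)
  obtain ⟨r', hr'⟩ := (singleFunctor A 0).map_surjective (r ≫ e.hom)
  refine ⟨N, e.symm, i', r', (singleFunctor A 0).map_injective ?_⟩
  rw [Functor.map_comp, hi', hr', Category.assoc, ← Category.assoc i, h, Category.id_comp,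
    e.inv_hom_id, CategoryTheory.Functor.map_id]

variable {ι : Type*} (P : ι → A) [∀ c, Projective (P c)]

/-- If Serre duality holds in a hereditary abelian category with enough projective objects,
then the functor `Hom(-, M)^*` on projective objects is finitely presented. -/
theorem exists_dual_presentation (hS : HasSerreDuality k (BoundedDerivedCategory A))
    (hA : ∀ M : A, HasProjectiveDimensionLT M 2)
    (hP : ∀ M : A, ∃ (c : ι) (π : P c ⟶ M), Epi π)
    (hR : ∀ (c : ι) (N : A) (i : N ⟶ P c) (r : P c ⟶ N), i ≫ r = 𝟙 N →
      ∃ c', Nonempty (N ≅ P c')) (M : A) :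
    ∃ (c₀ c₁ : ι) (u : P c₀ ⟶ P c₁) (θ : (P c₀ ⟶ M) →ₗ[k] k), ∀ (Q : A) [Projective Q],
      (∀ φ : (Q ⟶ M) →ₗ[k] k, ∃ x : P c₀ ⟶ Q, ∀ y, θ (x ≫ y) = φ y) ∧
      (∀ x : P c₀ ⟶ Q, (∀ y, θ (x ≫ y) = 0) ↔ ∃ x' : P c₁ ⟶ Q, u ≫ x' = x) := by
  have hA' := hasInjectiveDimensionLT_of_forall 2 hA
  have := hS.1
  obtain ⟨⟨X, hX⟩, ⟨p⟩⟩ := exists_serrePair_right hS ⟨(singleFunctor A 0).obj M, bounded_single 0 M⟩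
  obtain ⟨τ, left, rep⟩ : ∃ τ : (X ⟶ (singleFunctor A 0).obj M) →ₗ[k] k,
      (∀ (Y : DerivedCategory A) (_ : t.bounded Y) (x : X ⟶ Y),
        (∀ z : Y ⟶ (singleFunctor A 0).obj M, τ (x ≫ z) = 0) → x = 0) ∧
      (∀ (Y : DerivedCategory A) (_ : t.bounded Y) (φ : (Y ⟶ (singleFunctor A 0).obj M) →ₗ[k] k),
        ∃ x : X ⟶ Y, ∀ z, τ (x ≫ z) = φ z) := by
    refine ⟨{ toFun := fun f => p.t (ObjectProperty.homMk f)
              map_add' := fun f g => map_add p.t _ _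
              map_smul' := fun a f => map_smul p.t _ _ }, fun Y hY x hx => ?_, fun Y hY φ => ?_⟩
    · exact congrArg InducedCategory.Hom.hom
        (p.left (Y := ⟨Y, hY⟩) (ObjectProperty.homMk x) fun z => hx z.hom)
    · obtain ⟨x, hx⟩ := p.exists_left (Y := ⟨Y, hY⟩)
        { toFun := fun f => φ f.hom
          map_add' := fun f g => map_add φ f.hom g.hom
          map_smul' := fun a f => map_smul φ a f.hom }
      exact ⟨x.hom, fun z => hx (ObjectProperty.homMk z)⟩
  -- Hom(τ≥2 X, M) = 0 since M has injective dimension at most one. By duality X → τ≥2 X vanishes,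
  -- so X is a retract of τ≤1 X.
  have : t.IsLE X 1 := by
    obtain ⟨X₀, X₁, f, g, h, hT, hX₀, hX₁, _, _, -⟩ := exists_truncation hX 1 2 (by simp)
    have hg : g = 0 := left _ hX₁ g fun z => by
      rw [hom_eq_zero_of_isGE 2 2 0 (by simp) hX₁ z, comp_zero, map_zero]
    obtain ⟨i, hi⟩ := distTriang_coyoneda₂ hT (𝟙 X) (by rw [hg, comp_zero])
    exact isLE_of_retract i f hi.symm 1
  -- Cover the top degree of X by a projective; the cone `Y`, in degrees ≤ 0, turns out to be a
  -- representing projective itself.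
  obtain ⟨c₁, f₁, Y, a, h₁, hT₁, _⟩ := exists_singleFunctor_cone_isLE P hP 1 0 (by simp) X
  have hY : t.bounded Y := t.bounded.ext_of_isTriangulatedClosed₃ _ hT₁ (bounded_single 1 _) hX
  obtain ⟨c, r, Z, q, h, hT, _⟩ := exists_singleFunctor_cone_isLE P hP 0 (-1) (by simp) Y
  have hZ : t.bounded Z := t.bounded.ext_of_isTriangulatedClosed₃ _ hT (bounded_single 0 _) hY
  let e₁ : ((singleFunctor A 1).obj (P c₁))⟦(1 : ℤ)⟧ ≅ (singleFunctor A 0).obj (P c₁) :=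
    ((singleFunctors A).shiftIso 1 0 1 (by simp)).app (P c₁)
  -- X → Y → Z vanishes by duality with Hom(Z, M) = 0, so `q` factors through the projective P c₁ in
  -- degree 0, which has no maps to Z. Hence `Y` is a retract of P c.
  have hq : q = 0 := by
    obtain ⟨y, rfl⟩ := distTriang_yoneda₃ hT₁ q (left _ hZ _ fun z => by
      rw [t.zero z (-1) 0, comp_zero, map_zero])
    have : e₁.inv ≫ y = 0 := hom_eq_zero_of_isLE 1 0 (-1) (by simp) hZ _
    rw [← e₁.hom_inv_id_assoc y, this, comp_zero, comp_zero]
  obtain ⟨i, hi⟩ := distTriang_coyoneda₂ hT (𝟙 Y) (by rw [hq, comp_zero])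
  obtain ⟨N, e, i', r', hir⟩ := exists_iso_single_of_retract i r hi.symm
  obtain ⟨c₀, ⟨e'⟩⟩ := hR c N i' r' hir
  let ε : (singleFunctor A 0).obj (P c₀) ≅ Y := (singleFunctor A 0).mapIso e'.symm ≪≫ e
  obtain ⟨u, hu⟩ := (singleFunctor A 0).map_surjective (ε.hom ≫ h₁ ≫ e₁.hom)
  -- The triangle is now P c₁[-1] → X → P c₀ → P c₁; this is exactness of Hom(-, Q) at Hom(P c₀, Q).
  have exact₂ (Q : A) (x : P c₀ ⟶ Q) :
      a ≫ ε.inv ≫ (singleFunctor A 0).map x = 0 ↔ ∃ x', u ≫ x' = x := by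
    constructor
    · intro hx
      obtain ⟨y, hy⟩ := distTriang_yoneda₃ hT₁ _ hx
      obtain ⟨x', hx'⟩ := (singleFunctor A 0).map_surjective (e₁.inv ≫ y)
      refine ⟨x', (singleFunctor A 0).map_injective ?_⟩
      rw [Functor.map_comp, hu, hx', Category.assoc, Category.assoc, e₁.hom_inv_id_assoc, ← hy,
        ε.hom_inv_id_assoc]
    · rintro ⟨x', rfl⟩
      rw [Functor.map_comp, hu, Category.assoc, Category.assoc, ε.inv_hom_id_assoc,
        ← Category.assoc a, distTriang_comp₂₃ hT₁, zero_comp]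
  let θ : (P c₀ ⟶ M) →ₗ[k] k :=
    τ ∘ₗ Linear.leftComp k _ (a ≫ ε.inv) ∘ₗ (singleFunctor A 0).mapLinearMap k
  have hθ (Q : A) (x : P c₀ ⟶ Q) (y : Q ⟶ M) : θ (x ≫ y) =
      τ ((a ≫ ε.inv ≫ (singleFunctor A 0).map x) ≫ (singleFunctor A 0).map y) := by
    change τ ((a ≫ ε.inv) ≫ (singleFunctor A 0).map (x ≫ y)) = _
    simp only [Functor.map_comp, Category.assoc]
  refine ⟨c₀, c₁, u, θ, fun Q _ => ⟨fun φ => ?_, fun x => ?_⟩⟩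
  · obtain ⟨x, hx⟩ := rep _ (bounded_single 0 Q) (φ ∘ₗ (singleHomEquiv k 0 Q M).symm.toLinearMap)
    -- Every X → Q factors through P c₀, because Hom(P c₁[-1], Q) = 0 by projectivity.
    obtain ⟨x₁, rfl⟩ := distTriang_yoneda₂ hT₁ x
      (hom_eq_zero_of_isLE 1 1 0 (by simp) (bounded_single 0 Q) _)
    obtain ⟨x₂, hx₂⟩ := (singleFunctor A 0).map_surjective (ε.hom ≫ x₁)
    refine ⟨x₂, fun y => ?_⟩
    rw [hθ, hx₂, ε.inv_hom_id_assoc, hx]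
    exact congrArg φ ((singleHomEquiv k 0 Q M).symm_apply_apply y)
  · rw [← exact₂]
    constructor
    · intro hx
      refine left _ (bounded_single 0 Q) _ fun z => ?_
      obtain ⟨z, rfl⟩ := (singleFunctor A 0).map_surjective z
      rw [← hθ, hx]
    · intro hx y
      rw [hθ, hx, zero_comp, map_zero]

end DerivedLinear

/-! ### Modules over a linear category -/

section Modules

variable {k : Type v} [Field k] {C : Type u} [Category.{v} C] [Preadditive C] [Linear k C]

/-- The property of a functor to vector spaces of being a `k`-linear functor. -/
def IsLinearModule (M : Cᵒᵖ ⥤ ModuleCat.{v} k) : Prop :=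
  M.Additive ∧ ∀ {X Y : C} (a : k) (f : X ⟶ Y), M.map (a • f).op = a • M.map f.op

lemma IsLinearModule.map_add {M : Cᵒᵖ ⥤ ModuleCat.{v} k} (hM : IsLinearModule M) {X Y : C}
    (f g : X ⟶ Y) (x : M.obj (op Y)) :
    M.map (f + g).op x = M.map f.op x + M.map g.op x := by
  have := hM.1
  rw [op_add, Functor.map_add]
  rfl

lemma IsLinearModule.map_sub {M : Cᵒᵖ ⥤ ModuleCat.{v} k} (hM : IsLinearModule M) {X Y : C}
    (f g : X ⟶ Y) (x : M.obj (op Y)) :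
    M.map (f - g).op x = M.map f.op x - M.map g.op x := by
  rw [eq_sub_iff_add_eq, ← hM.map_add, sub_add_cancel]

lemma IsLinearModule.map_smul {M : Cᵒᵖ ⥤ ModuleCat.{v} k} (hM : IsLinearModule M) {X Y : C}
    (a : k) (f : X ⟶ Y) (x : M.obj (op Y)) :
    M.map (a • f).op x = a • M.map f.op x := by
  rw [hM.2]
  rfl

lemma IsLinearModule.of_epi {M N : Cᵒᵖ ⥤ ModuleCat.{v} k} (hM : IsLinearModule M) (p : M ⟶ N)
    [Epi p] : IsLinearModule N := by
  have := hM.1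
  refine ⟨⟨fun {X Y f g} => ?_⟩, fun {X Y} a f => ?_⟩
  · rw [← cancel_epi (p.app X), ← p.naturality]
    simp only [Functor.map_add, Preadditive.add_comp, Preadditive.comp_add, p.naturality]
  · rw [← cancel_epi (p.app (op Y)), ← p.naturality, Linear.comp_smul, ← p.naturality,
      ← Linear.smul_comp, hM.2]

omit [Preadditive C] [Linear k C] in
/-- A natural transformation is compatible with the action of morphisms on elements. -/
lemma naturality_apply {M N : Cᵒᵖ ⥤ ModuleCat.{v} k} (α : M ⟶ N) {X Y : C} (f : X ⟶ Y)
    (x : M.obj (op Y)) : α.app (op X) (M.map f.op x) = N.map f.op (α.app (op Y) x) :=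
  ConcreteCategory.congr_hom (α.naturality f.op) x

omit [Preadditive C] [Linear k C] in
lemma map_comp_apply (M : Cᵒᵖ ⥤ ModuleCat.{v} k) {X Y Z : C} (f : X ⟶ Y) (g : Y ⟶ Z)
    (x : M.obj (op Z)) : M.map (f ≫ g).op x = M.map f.op (M.map g.op x) := by
  rw [op_comp, Functor.map_comp]
  rfl

omit [Preadditive C] [Linear k C] in
lemma map_id_apply (M : Cᵒᵖ ⥤ ModuleCat.{v} k) {X : C} (x : M.obj (op X)) :
    M.map (𝟙 X).op x = x := by
  rw [op_id, CategoryTheory.Functor.map_id]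
  rfl

/-- The Yoneda lemma: the morphism from a representable functor given by an element. -/
def yonedaMap {M : Cᵒᵖ ⥤ ModuleCat.{v} k} (hM : IsLinearModule M) {B : C} (x : M.obj (op B)) :
    (linearYoneda k C).obj B ⟶ M where
  app X := ModuleCat.ofHom (X := X.unop ⟶ B)
    { toFun := fun f => M.map f.op x
      map_add' := fun f g => hM.map_add f g x
      map_smul' := fun a f => hM.map_smul a f x }
  naturality X Y f := by
    ext g
    exact map_comp_apply M f.unop g x

lemma linearYoneda_app_apply {M : Cᵒᵖ ⥤ ModuleCat.{v} k} {B : C}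
    (p : (linearYoneda k C).obj B ⟶ M) {X : C} (f : X ⟶ B) :
    p.app (op X) f = M.map f.op (p.app (op B) (𝟙 B)) := by
  refine Eq.trans ?_ (naturality_apply p f (𝟙 B))
  exact congrArg (p.app (op X)) (Category.comp_id f).symm

lemma linearYoneda_hom_ext {M : Cᵒᵖ ⥤ ModuleCat.{v} k} {B : C}
    {p q : (linearYoneda k C).obj B ⟶ M} (h : p.app (op B) (𝟙 B) = q.app (op B) (𝟙 B)) :
    p = q := by
  ext X f
  exact (linearYoneda_app_apply p f).trans (h ▸ (linearYoneda_app_apply q f).symm)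

/-! ### Exactness of modules -/

omit [Preadditive C] [Linear k C] in
lemma exact_evaluation {S : ShortComplex (Cᵒᵖ ⥤ ModuleCat.{v} k)} (hS : S.Exact) (X : C)
    (y : S.X₂.obj (op X)) (hy : S.g.app (op X) y = 0) : ∃ x, S.f.app (op X) x = y :=
  (ShortComplex.moduleCat_exact_iff _).1 (hS.map ((evaluation _ _).obj (op X))) y hy

omit [Preadditive C] [Linear k C] in
lemma exact_of_evaluation {S : ShortComplex (Cᵒᵖ ⥤ ModuleCat.{v} k)}
    (hS : ∀ (X : C) (y : S.X₂.obj (op X)), S.g.app (op X) y = 0 → ∃ x, S.f.app (op X) x = y) :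
    S.Exact := by
  refine S.exact_iff_isZero_homology.2 ((Functor.isZero_iff _).2 fun X => ?_)
  have : (S.map ((evaluation _ _).obj X)).Exact :=
    (ShortComplex.moduleCat_exact_iff _).2 (hS X.unop)
  exact ((S.map ((evaluation _ _).obj X)).exact_iff_isZero_homology.1 this).of_iso
    (S.mapHomologyIso ((evaluation _ _).obj X)).symm

omit [Preadditive C] [Linear k C] in
lemma app_surjective_of_epi {M N : Cᵒᵖ ⥤ ModuleCat.{v} k} (p : M ⟶ N) [Epi p] (X : C) :
    Function.Surjective (p.app (op X)) :=
  (ModuleCat.epi_iff_surjective _).1 inferInstance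

omit [Preadditive C] [Linear k C] in
lemma epi_of_app_surjective {M N : Cᵒᵖ ⥤ ModuleCat.{v} k} (p : M ⟶ N)
    (h : ∀ X : C, Function.Surjective (p.app (op X))) : Epi p :=
  (NatTrans.epi_iff_epi_app p).2 fun X => (ModuleCat.epi_iff_surjective _).2 (h X.unop)

omit [Preadditive C] [Linear k C] in
lemma isIso_of_app_bijective {M N : Cᵒᵖ ⥤ ModuleCat.{v} k} (p : M ⟶ N)
    (h : ∀ X : C, Function.Bijective (p.app (op X))) : IsIso p :=
  have (X : Cᵒᵖ) : IsIso (p.app X) := (ConcreteCategory.isIso_iff_bijective _).2 (h X.unop)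
  NatIso.isIso_of_isIso_app p

/-- Yoneda turns a presentation into a generator x in M(B) whose annihilator is the set of maps
factoring through `f`. -/
lemma finitelyPresented.exists_generator {M : Cᵒᵖ ⥤ ModuleCat.{v} k}
    (hM : finitelyPresented k C M) :
    ∃ (A B : C) (f : A ⟶ B) (x : M.obj (op B)), M.map f.op x = 0 ∧
      (∀ (X : C) (y : M.obj (op X)), ∃ g : X ⟶ B, M.map g.op x = y) ∧
      (∀ (X : C) (g : X ⟶ B), M.map g.op x = 0 → ∃ h, h ≫ f = g) := by
  obtain ⟨A, B, f, p, w, hS, hp⟩ := hM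
  refine ⟨A, B, f, p.app (op B) (𝟙 B), ?_, fun X y => ?_, fun X g hg => ?_⟩
  · rw [← linearYoneda_app_apply p f]
    have := ConcreteCategory.congr_hom (NatTrans.congr_app w (op A)) (𝟙 A)
    exact (congrArg (p.app (op A)) (Category.id_comp f).symm).trans this
  · obtain ⟨g, hg⟩ := app_surjective_of_epi p X y
    exact ⟨g, (linearYoneda_app_apply p g).symm.trans hg⟩
  · exact exact_evaluation hS X g ((linearYoneda_app_apply p g).trans hg)

lemma finitelyPresented_of_generator {M : Cᵒᵖ ⥤ ModuleCat.{v} k} (hM : IsLinearModule M) {A B : C}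
    (f : A ⟶ B) (x : M.obj (op B)) (hx : M.map f.op x = 0)
    (h₁ : ∀ (X : C) (y : M.obj (op X)), ∃ g : X ⟶ B, M.map g.op x = y)
    (h₂ : ∀ (X : C) (g : X ⟶ B), M.map g.op x = 0 → ∃ h, h ≫ f = g) :
    finitelyPresented k C M := by
  refine ⟨A, B, f, yonedaMap hM x, linearYoneda_hom_ext ?_, exact_of_evaluation fun X g hg =>
    h₂ X g hg, epi_of_app_surjective _ h₁⟩
  exact (congrArg (fun g : A ⟶ B => M.map g.op x) (Category.id_comp f)).trans hx

lemma isLinearModule_linearYoneda (B : C) : IsLinearModule ((linearYoneda k C).obj B) :=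
  ⟨inferInstance, fun a _ => by
    ext g
    exact Linear.smul_comp _ _ _ a _ g⟩

lemma finitelyPresented_linearYoneda (B : C) :
    finitelyPresented k C ((linearYoneda k C).obj B) :=
  finitelyPresented_of_generator (isLinearModule_linearYoneda B) (0 : B ⟶ B) (𝟙 B) zero_comp
    (fun _ g => ⟨g, Category.comp_id g⟩) (fun _ g hg => ⟨0, zero_comp.trans
      ((Category.comp_id g).symm.trans hg).symm⟩)

/-- The generator of N still generates; the biproduct joins its old relations with a lift `b` of the
image of the generator of M. -/
lemma finitelyPresented_cokernel [HasBinaryBiproducts C] {M N : Cᵒᵖ ⥤ ModuleCat.{v} k}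
    (hM : finitelyPresented k C M) (hN : finitelyPresented k C N) (α : M ⟶ N) :
    finitelyPresented k C (cokernel α) := by
  obtain ⟨A₁, B₁, f₁, x₁, -, gen₁, -⟩ := hM.exists_generator
  obtain ⟨A₂, B₂, f₂, x₂, hx₂, gen₂, rel₂⟩ := hN.exists_generator
  obtain ⟨b, hb⟩ := gen₂ B₁ (α.app _ x₁)
  have hN' : IsLinearModule N := hN.linear
  have hα (X : C) (y : M.obj (op X)) : (cokernel.π α).app (op X) (α.app (op X) y) = 0 :=
    ConcreteCategory.congr_hom (NatTrans.congr_app (cokernel.condition α) (op X)) y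
  refine finitelyPresented_of_generator (hN'.of_epi (cokernel.π α)) (biprod.desc b f₂)
    ((cokernel.π α).app _ x₂) ?_ (fun X y => ?_) (fun X g hg => ?_)
  · rw [← naturality_apply, biprod.desc_eq, hN'.map_add, map_comp_apply, map_comp_apply, hb, hx₂,
      map_zero, add_zero, ← naturality_apply, hα]
  · obtain ⟨y, rfl⟩ := app_surjective_of_epi (cokernel.π α) X y
    obtain ⟨g, rfl⟩ := gen₂ X y
    exact ⟨g, (naturality_apply _ _ _).symm⟩
  · rw [← naturality_apply] at hg
    obtain ⟨m, hm⟩ := exact_evaluation (ShortComplex.exact_cokernel α) X _ hg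
    obtain ⟨g₁, rfl⟩ := gen₁ X m
    obtain ⟨h, hh⟩ := rel₂ X (g - g₁ ≫ b) (by
      rw [hN'.map_sub, map_comp_apply, hb, ← naturality_apply]
      exact sub_eq_zero.2 hm.symm)
    exact ⟨biprod.lift g₁ h, by rw [biprod.lift_desc, hh, add_sub_cancel]⟩

/-! ### The category of finitely presented modules -/

variable (k C) in
/-- The Yoneda embedding into finitely presented modules. -/
def fpYoneda : C ⥤ FPMod k C :=
  (finitelyPresented k C).lift (linearYoneda k C) finitelyPresented_linearYoneda

instance : (fpYoneda k C).Full := inferInstanceAs (ObjectProperty.lift _ _ _).Full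

instance : (fpYoneda k C).Faithful := inferInstanceAs (ObjectProperty.lift _ _ _).Faithful

instance : (fpYoneda k C).Additive where
  map_add {X Y f g} := ObjectProperty.hom_ext _ (by
    ext Z h
    exact Preadditive.comp_add _ _ _ h f g)

instance : (fpYoneda k C).Linear k where
  map_smul {X Y} f a := ObjectProperty.hom_ext _ (by
    ext Z h
    exact Linear.comp_smul _ _ _ h a f)

/-- The Yoneda lemma for finitely presented modules. -/
def fpYonedaEquiv (B : C) (M : FPMod k C) : ((fpYoneda k C).obj B ⟶ M) ≃ₗ[k] M.obj.obj (op B) where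
  toFun f := f.hom.app (op B) (𝟙 B)
  invFun x := ObjectProperty.homMk (yonedaMap M.property.linear x)
  map_add' _ _ := rfl
  map_smul' _ _ := rfl
  left_inv _ := ObjectProperty.hom_ext _ (linearYoneda_hom_ext (map_id_apply M.obj _))
  right_inv x := map_id_apply M.obj x

lemma fpYonedaEquiv_comp {B : C} {M N : FPMod k C} (f : (fpYoneda k C).obj B ⟶ M) (g : M ⟶ N) :
    fpYonedaEquiv B N (f ≫ g) = g.hom.app (op B) (fpYonedaEquiv B M f) := rfl

lemma fpYonedaEquiv_map_comp {A B : C} {M : FPMod k C} (f : A ⟶ B)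
    (g : (fpYoneda k C).obj B ⟶ M) :
    fpYonedaEquiv A M ((fpYoneda k C).map f ≫ g) = M.obj.map f.op (fpYonedaEquiv B M g) := by
  refine Eq.trans ?_ (linearYoneda_app_apply g.hom f)
  exact congrArg (g.hom.app (op A)) (Category.id_comp f)

lemma fpMod_epi_of_app_surjective {M N : FPMod k C} (f : M ⟶ N)
    (h : ∀ X : C, Function.Surjective (f.hom.app (op X))) : Epi f :=
  have : Epi ((finitelyPresented k C).ι.map f) := epi_of_app_surjective f.hom h
  (finitelyPresented k C).ι.epi_of_epi_map this

lemma fpMod_mono_of_app_injective {M N : FPMod k C} (f : M ⟶ N)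
    (h : ∀ X : C, Function.Injective (f.hom.app (op X))) : Mono f where
  right_cancellation g g' hg := ObjectProperty.hom_ext _ (by
    ext X x
    exact h _ (ConcreteCategory.congr_hom (NatTrans.congr_app (congrArg (fun f => f.hom) hg) X) x))

lemma fpMod_app_injective {M N : FPMod k C} (f : M ⟶ N) [Mono f] (X : C) :
    Function.Injective (f.hom.app (op X)) := fun x y h => by
  obtain ⟨x, rfl⟩ := (fpYonedaEquiv X M).surjective x
  obtain ⟨y, rfl⟩ := (fpYonedaEquiv X M).surjective y
  rw [← fpYonedaEquiv_comp, ← fpYonedaEquiv_comp] at h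
  rw [(cancel_mono f).1 ((fpYonedaEquiv X N).injective h)]

/-- The cokernel taken among all functors is finitely presented, so an epimorphism of `FPMod`
already has zero cokernel there. -/
lemma fpMod_app_surjective [HasBinaryBiproducts C] {M N : FPMod k C} (f : M ⟶ N) [Epi f] (X : C) :
    Function.Surjective (f.hom.app (op X)) := fun y => by
  let Q : FPMod k C := ⟨_, finitelyPresented_cokernel M.property N.property f.hom⟩
  let π : N ⟶ Q := ObjectProperty.homMk (cokernel.π f.hom)
  have hπ : π = 0 := by
    rw [← cancel_epi f, comp_zero]
    exact ObjectProperty.hom_ext _ (cokernel.condition f.hom)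
  refine exact_evaluation (ShortComplex.exact_cokernel f.hom) X y ?_
  exact ConcreteCategory.congr_hom (NatTrans.congr_app (congrArg (fun f => f.hom) hπ) (op X)) y

instance [HasBinaryBiproducts C] (B : C) : Projective ((fpYoneda k C).obj B) where
  factors {M N} f e he := by
    obtain ⟨x, hx⟩ := fpMod_app_surjective e B (fpYonedaEquiv B N f)
    refine ⟨(fpYonedaEquiv B _).symm x, (fpYonedaEquiv B _).injective ?_⟩
    rw [fpYonedaEquiv_comp, LinearEquiv.apply_symm_apply, hx]

lemma exists_epi_fpYoneda (M : FPMod k C) :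
    ∃ (B : C) (p : (fpYoneda k C).obj B ⟶ M), ∀ X : C, Function.Surjective (p.hom.app (op X)) := by
  obtain ⟨A, B, f, x, -, gen, -⟩ := M.property.exists_generator
  exact ⟨B, (fpYonedaEquiv B M).symm x, gen⟩

section

variable [∀ X Y : C, Module.Finite k (X ⟶ Y)]

lemma finite_obj (M : FPMod k C) (X : C) : Module.Finite k (M.obj.obj (op X)) := by
  obtain ⟨B, p, hp⟩ := exists_epi_fpYoneda M
  have : Module.Finite k (((fpYoneda k C).obj B).obj.obj (op X)) :=
    inferInstanceAs (Module.Finite k (X ⟶ B))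
  exact Module.Finite.of_surjective (p.hom.app (op X)).hom (hp X)

lemma finite_fpMod_hom (M N : FPMod k C) : Module.Finite k (M ⟶ N) := by
  obtain ⟨B, p, hp⟩ := exists_epi_fpYoneda M
  have := finite_obj N B
  have := fpMod_epi_of_app_surjective p hp
  exact Module.Finite.of_injective ((fpYonedaEquiv B N).toLinearMap ∘ₗ Linear.leftComp k N p)
    ((fpYonedaEquiv B N).injective.comp fun f g h => (cancel_epi p).1 h)

end

/-- A retract of an object in the image of a fully faithful functor from an idempotent complete
category is isomorphic to an object in the image. -/
lemma exists_iso_of_retract {C' : Type*} [Category C'] {D : Type*} [Category D]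
    [IsIdempotentComplete C'] (F : C' ⥤ D) [F.Full] [F.Faithful] {B : C'} {N : D}
    (i : N ⟶ F.obj B) (r : F.obj B ⟶ N) (h : i ≫ r = 𝟙 N) : ∃ B', Nonempty (N ≅ F.obj B') := by
  obtain ⟨e, he⟩ := F.map_surjective (r ≫ i)
  obtain ⟨B', i', r', hi, hr⟩ := IsIdempotentComplete.idempotents_split B e (F.map_injective (by
    rw [F.map_comp, he, Category.assoc, ← Category.assoc i, h, Category.id_comp]))
  refine ⟨B', ⟨⟨i ≫ F.map r', F.map i' ≫ r, ?_, ?_⟩⟩⟩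
  · rw [Category.assoc, ← Category.assoc (F.map r'), ← F.map_comp, hr, he, Category.assoc,
      h, Category.comp_id, h]
  · rw [Category.assoc, ← Category.assoc r, ← he, ← F.map_comp, ← F.map_comp, ← hr,
      Category.assoc, hi, Category.comp_id, hi, CategoryTheory.Functor.map_id]

end Modules


/-! ### Resolutions in hereditary categories -/

section Resolutions

variable {A : Type u} [Category.{v} A] [Abelian A]

/-- Dimension shifting makes the kernel of a cover projective; it then splits off its own cover, and
`Q` is closed under retracts. -/
lemma exists_projective_resolution (hA : ∀ M : A, HasProjectiveDimensionLT M 2)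
    (Q : ObjectProperty A) (hQ : ∀ P, Q P → Projective P)
    (cover : ∀ M, ∃ (P : A) (π : P ⟶ M), Q P ∧ Epi π)
    (retract : ∀ (N P : A) (i : N ⟶ P) (r : P ⟶ N), i ≫ r = 𝟙 N → Q P → Q N) (M : A) :
    ∃ S : ShortComplex A, S.ShortExact ∧ S.X₃ = M ∧ Q S.X₁ ∧ Q S.X₂ := by
  obtain ⟨P, π, hP, _⟩ := cover M
  have hS : (ShortComplex.mk _ _ (kernel.condition π)).ShortExact :=
    { exact := ShortComplex.exact_kernel π }
  have : Projective (kernel π) := by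
    rw [projective_iff_hasProjectiveDimensionLT_one]
    exact (hS.hasProjectiveDimensionLT_X₃_iff 0 (hQ P hP)).1 (hA M)
  obtain ⟨P', π', hP', _⟩ := cover (kernel π)
  exact ⟨_, hS, rfl, retract _ _ (Projective.factorThru (𝟙 _) π') π'
    (Projective.factorThru_comp _ _) hP', hP⟩

lemma exists_injective_resolution (hA : ∀ M : A, HasInjectiveDimensionLT M 2)
    (Q : ObjectProperty A) (hQ : ∀ I, Q I → Injective I)
    (embed : ∀ M, ∃ (I : A) (j : M ⟶ I), Q I ∧ Mono j)
    (retract : ∀ (N I : A) (i : N ⟶ I) (r : I ⟶ N), i ≫ r = 𝟙 N → Q I → Q N) (M : A) :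
    ∃ S : ShortComplex A, S.ShortExact ∧ S.X₁ = M ∧ Q S.X₂ ∧ Q S.X₃ := by
  obtain ⟨I, j, hI, _⟩ := embed M
  have hS : (ShortComplex.mk _ _ (cokernel.condition j)).ShortExact :=
    { exact := ShortComplex.exact_cokernel j }
  have : Injective (cokernel j) := by
    rw [injective_iff_hasInjectiveDimensionLT_one]
    exact (hS.hasInjectiveDimensionLT_X₃_iff 0 (hQ I hI)).2 (hA M)
  obtain ⟨I', j', hI', _⟩ := embed (cokernel j)
  exact ⟨_, hS, rfl, hI, retract _ _ j' (Injective.factorThru (𝟙 _) j')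
    (Injective.comp_factorThru _ _) hI'⟩

end Resolutions

/-! ### The duality on finitely presented modules -/

section Duality

variable {k : Type v} [Field k] {C : Type u} [Category.{v} C] [Preadditive C] [Linear k C]

/-- An injective object which represents the functor `M ↦ Hom_k(M(c), k)`. -/
def IsInjectiveAt (c : C) (I : FPMod k C) : Prop :=
  ∃ θ : Module.Dual k (I.obj.obj (op c)), ∀ Y : FPMod k C,
    Function.Bijective fun z : Y ⟶ I => θ ∘ₗ (z.hom.app (op c)).hom

/-- Morphisms Y → I are functionals on Y(c), and functionals extend along the injection X(c) → Y(c).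
-/
lemma IsInjectiveAt.injective {c : C} {I : FPMod k C} (h : IsInjectiveAt c I) : Injective I := by
  obtain ⟨θ, hθ⟩ := h
  refine ⟨fun {X Y} g i hi => ?_⟩
  obtain ⟨l, hl⟩ := LinearMap.exists_leftInverse_of_injective (i.hom.app (op c)).hom
    (LinearMap.ker_eq_bot.2 (fpMod_app_injective i c))
  obtain ⟨z, hz⟩ := (hθ Y).2 (θ ∘ₗ (g.hom.app (op c)).hom ∘ₗ l)
  refine ⟨z, (hθ X).1 (LinearMap.ext fun x => ?_)⟩
  refine (LinearMap.congr_fun hz (i.hom.app (op c) x)).trans ?_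
  exact congrArg (fun y => θ (g.hom.app (op c) y)) (LinearMap.congr_fun hl x)

lemma IsInjectiveAt.nonempty_serrePair {c : C} {I : FPMod k C} (h : IsInjectiveAt c I) :
    Nonempty (SerrePair k ((fpYoneda k C).obj c) I) := by
  obtain ⟨θ, hθ⟩ := h
  refine ⟨⟨θ ∘ₗ (fpYonedaEquiv c I).toLinearMap, fun {Y} x hx => ?_, fun {Y} z hz => ?_⟩⟩
  · refine (fpYonedaEquiv c Y).map_eq_zero_iff.1
      ((Module.forall_dual_apply_eq_zero_iff k _).1 fun φ => ?_)
    obtain ⟨z, rfl⟩ := (hθ Y).2 φ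
    exact hx z
  · refine (hθ Y).1 (LinearMap.ext fun y => ?_)
    obtain ⟨x, rfl⟩ := (fpYonedaEquiv c Y).surjective y
    exact (hz x).trans (map_zero θ).symm

section

variable (hdual : ∀ M : (FPMod k C)ᵒᵖ, finitelyPresented k Cᵒᵖ
  (((finitelyPresented k C).ι.op ⋙ dualFunctor k C).obj M))

/-- The functor `D` on finitely presented modules. -/
abbrev fpDual : (FPMod k C)ᵒᵖ ⥤ FPMod k Cᵒᵖ :=
  (finitelyPresented k Cᵒᵖ).lift ((finitelyPresented k C).ι.op ⋙ dualFunctor k C) hdual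

/-- Hom(Y, I) ≅ Hom(DI, DY) ≅ Hom(C(c, -), DY) ≅ Y(c)^*, by full faithfulness of D and Yoneda. -/
lemma isInjectiveAt_of_iso [(fpDual hdual).IsEquivalence] {c : C} {I : FPMod k C}
    (e : (fpYoneda k Cᵒᵖ).obj (op c) ≅ (fpDual hdual).obj (op I)) : IsInjectiveAt c I := by
  refine ⟨fpYonedaEquiv (op c) _ e.hom, fun Y => ?_⟩
  have : Function.Bijective fun z : Y ⟶ I =>
      fpYonedaEquiv (op c) _ (e.hom ≫ (fpDual hdual).map z.op) := by
    refine (fpYonedaEquiv (op c) ((fpDual hdual).obj (op Y))).bijective.comp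
      (.comp (g := fun f => e.hom ≫ f) ⟨fun f g h => (cancel_epi e.hom).1 h, fun f =>
        ⟨e.inv ≫ f, e.hom_inv_id_assoc f⟩⟩
      (.comp (g := (fpDual hdual).map) ⟨(fpDual hdual).map_injective, (fpDual hdual).map_surjective⟩
        ⟨Quiver.Hom.op_inj, fun f => ⟨f.unop, rfl⟩⟩))
  exact this

lemma fpMod_mono_of_fpDual_surjective {M N : FPMod k C} (f : M ⟶ N)
    (h : ∀ X : Cᵒᵖ, Function.Surjective (((fpDual hdual).map f.op).hom.app (op X))) : Mono f := by
  refine fpMod_mono_of_app_injective f fun X => (injective_iff_map_eq_zero _).2 fun x hx => ?_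
  refine (Module.forall_dual_apply_eq_zero_iff k x).1 fun φ => ?_
  obtain ⟨ψ, rfl⟩ := h (op X) φ
  exact (congrArg (DFunLike.coe (F := Module.Dual k (N.obj.obj (op X))) ψ) hx).trans
    (map_zero (F := Module.Dual k (N.obj.obj (op X))) ψ)

end

end Duality

/-! ### From dualizing varieties to Serre duality -/

section

variable {k : Type v} [Field k] {C : Type u} [Category.{v} C] [Preadditive C] [Linear k C]

theorem abelianHasSerreDuality_of_isDualizing (hC : IsDualizing k C) (h : IsAbelian (FPMod k C))
    (hh : letI := h.toAbelian; IsHereditary (FPMod k C)) :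
    letI := h.toAbelian; AbelianHasSerreDuality k (FPMod k C) := by
  let := h.toAbelian
  let := HasDerivedCategory.standard (FPMod k C)
  have := hC.isFiniteVariety.homFinite
  have := hC.isFiniteVariety.isIdempotentComplete
  have := hC.isFiniteVariety.hasFiniteBiproducts
  have := hasBinaryBiproducts_of_finite_biproducts C
  let F : (FPMod k C)ᵒᵖ ⥤ FPMod k Cᵒᵖ := fpDual hC.dual_mem
  have hF : F.IsEquivalence := hC.isEquivalence
  let J (c : C) (I : FPMod k C) : Prop :=
    Nonempty ((fpYoneda k Cᵒᵖ).obj (op c) ≅ F.obj (op I))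
  have hJ {c : C} {I : FPMod k C} : J c I → IsInjectiveAt c I := fun ⟨e⟩ =>
    isInjectiveAt_of_iso hC.dual_mem e
  have exJ (c : C) : ∃ I, J c I :=
    ⟨(F.objPreimage ((fpYoneda k Cᵒᵖ).obj (op c))).unop,
      ⟨(F.objObjPreimageIso ((fpYoneda k Cᵒᵖ).obj (op c))).symm⟩⟩
  have hJ₀ {c : C} {I : FPMod k C} (hI : J c I) :
      Injective I ∧ Nonempty (SerrePair k ((fpYoneda k C).obj c) I) :=
    ⟨(hJ hI).injective, (hJ hI).nonempty_serrePair⟩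
  refine hasSerreDuality_boundedDerivedCategory k finite_fpMod_hom (fun M => ?_) (fun M => ?_)
  · obtain ⟨S, hS, rfl, ⟨c₁, ⟨e₁⟩⟩, ⟨c₂, ⟨e₂⟩⟩⟩ := exists_projective_resolution hh
      (fun P => ∃ c, Nonempty (P ≅ (fpYoneda k C).obj c))
      (fun P ⟨c, ⟨e⟩⟩ => Projective.of_iso e.symm inferInstance)
      (fun M => by
        obtain ⟨B, p, hp⟩ := exists_epi_fpYoneda M
        exact ⟨_, p, ⟨B, ⟨Iso.refl _⟩⟩, fpMod_epi_of_app_surjective p hp⟩)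
      (fun N P i r hir ⟨c, ⟨e⟩⟩ => exists_iso_of_retract (fpYoneda k C) (i ≫ e.hom) (e.inv ≫ r)
        (by simp [hir])) M
    have hX {X : FPMod k C} {c : C} (e : X ≅ (fpYoneda k C).obj c) :
        Projective X ∧ ∃ I, Injective I ∧ Nonempty (SerrePair k X I) := by
      obtain ⟨I, hI⟩ := exJ c
      obtain ⟨h₁, ⟨p⟩⟩ := hJ₀ hI
      exact ⟨Projective.of_iso e.symm inferInstance, I, h₁, ⟨p.ofIso e.symm (Iso.refl I)⟩⟩
    exact ⟨S, hS, rfl, hX e₁, hX e₂⟩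
  · obtain ⟨S, hS, rfl, ⟨c₂, h₂⟩, ⟨c₃, h₃⟩⟩ := exists_injective_resolution
      (hasInjectiveDimensionLT_of_forall 2 hh)
      (fun I => ∃ c, J c I) (fun I ⟨c, hI⟩ => (hJ₀ hI).1)
      (fun M => by
        -- A representable cover of DM is D of a map M → I, which is mono because its dual is
        -- pointwise surjective.
        obtain ⟨b, p, hp⟩ := exists_epi_fpYoneda (F.obj (op M))
        obtain ⟨I, hI⟩ := exJ b.unop
        obtain ⟨e⟩ := id hI
        obtain ⟨j, hj⟩ := F.map_surjective (e.inv ≫ p)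
        refine ⟨I, j.unop, ⟨b.unop, hI⟩, fpMod_mono_of_fpDual_surjective hC.dual_mem _ fun X => ?_⟩
        have : F.map j.unop.op = e.inv ≫ p := hj
        intro y
        obtain ⟨x, rfl⟩ := hp X y
        refine ⟨e.hom.hom.app (op X) x, ?_⟩
        have : e.hom ≫ F.map j.unop.op = p := by rw [this, e.hom_inv_id_assoc]
        exact ConcreteCategory.congr_hom (NatTrans.congr_app
          (congrArg (fun f => f.hom) this) (op X)) x)
      -- D turns a retract of I into a retract of a representable, which is representable since
      -- idempotents split.
      (fun N I i r hir ⟨c, ⟨e⟩⟩ => by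
        obtain ⟨c', ⟨e'⟩⟩ := exists_iso_of_retract (fpYoneda k Cᵒᵖ) (F.map r.op ≫ e.inv)
          (e.hom ≫ F.map i.op) (by
            rw [Category.assoc, e.inv_hom_id_assoc, ← F.map_comp, ← op_comp, hir, op_id, F.map_id])
        exact ⟨c'.unop, ⟨e'.symm⟩⟩) M
    exact ⟨S, hS, rfl, ⟨(hJ₀ h₂).1, _, inferInstance, (hJ₀ h₂).2⟩,
      ⟨(hJ₀ h₃).1, _, inferInstance, (hJ₀ h₃).2⟩⟩

end


/-! ### From Serre duality to dualizing varieties -/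

section

variable {k : Type v} [Field k] {C : Type u} [Category.{v} C] [Preadditive C] [Linear k C]

lemma IsLinearModule.dual {M : Cᵒᵖ ⥤ ModuleCat.{v} k} (hM : IsLinearModule M) :
    IsLinearModule ((dualFunctor k C).obj (op M)) := by
  refine ⟨⟨fun {X Y f g} => ?_⟩, fun {X Y} a f => ?_⟩
  · refine ModuleCat.hom_ext (LinearMap.ext fun (φ : Module.Dual k (M.obj X.unop)) =>
      LinearMap.ext fun x => ?_)
    exact (congrArg φ (hM.map_add f.unop.unop g.unop.unop x)).trans (_root_.map_add φ _ _)
  · refine ModuleCat.hom_ext (LinearMap.ext fun (φ : Module.Dual k (M.obj (op Y.unop))) =>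
      LinearMap.ext fun x => ?_)
    exact (congrArg φ (hM.map_smul a f.unop x)).trans (_root_.map_smul φ _ _)

omit [Preadditive C] [Linear k C] in
lemma dualFunctor_map_injective {M N : Cᵒᵖ ⥤ ModuleCat.{v} k} {f g : M ⟶ N}
    (h : (dualFunctor k C).map f.op = (dualFunctor k C).map g.op) : f = g := by
  ext X x
  refine sub_eq_zero.1 ((Module.forall_dual_apply_eq_zero_iff k _).1 fun φ => ?_)
  have : φ (f.app X x) = φ (g.app X x) :=
    LinearMap.congr_fun (ConcreteCategory.congr_hom (NatTrans.congr_app h (op X)) φ) x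
  rw [map_sub, this, sub_self]

-- The preimage is the transpose of `α`, with N(X) identified with its bidual by finite dimension.
omit [Preadditive C] [Linear k C] in
lemma dualFunctor_map_surjective {M N : Cᵒᵖ ⥤ ModuleCat.{v} k}
    [∀ X, Module.Finite k (N.obj X)]
    (α : (dualFunctor k C).obj (op N) ⟶ (dualFunctor k C).obj (op M)) :
    ∃ f : M ⟶ N, (dualFunctor k C).map f.op = α := by
  let a (X : Cᵒᵖ) : Module.Dual k (N.obj X) →ₗ[k] Module.Dual k (M.obj X) := (α.app (op X)).hom
  let b (X : Cᵒᵖ) : M.obj X →ₗ[k] N.obj X :=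
    (Module.evalEquiv k (N.obj X)).symm.toLinearMap ∘ₗ (a X).dualMap ∘ₗ Module.Dual.eval k (M.obj X)
  have hb (X : Cᵒᵖ) (φ : Module.Dual k (N.obj X)) (x : M.obj X) : φ (b X x) = a X φ x :=
    Module.apply_evalEquiv_symm_apply _ _ _ _
  have ha {X Y : Cᵒᵖ} (f : X ⟶ Y) (φ : Module.Dual k (N.obj Y)) (x : M.obj X) :
      a X (φ ∘ₗ (N.map f).hom) x = a Y φ (M.map f x) :=
    LinearMap.congr_fun (ConcreteCategory.congr_hom (α.naturality f.op) φ) x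
  refine ⟨{ app := fun X => ModuleCat.ofHom (b X), naturality := fun X Y f => ?_ }, ?_⟩
  · ext x
    refine sub_eq_zero.1 ((Module.forall_dual_apply_eq_zero_iff k _).1 fun φ => ?_)
    rw [map_sub, sub_eq_zero]
    exact (hb Y φ _).trans ((ha f φ x).symm.trans (hb X (φ ∘ₗ (N.map f).hom) x).symm)
  · ext X φ
    exact LinearMap.ext fun x => hb X.unop φ x

/-- `θ` is an element of (DM)(c₀): `h₁` says that it generates DM, `h₂` that `u` generates its
relations. -/
lemma finitelyPresented_dual_of_presentation (M : FPMod k C) {c₀ c₁ : C} (u : c₀ ⟶ c₁)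
    (θ : ((fpYoneda k C).obj c₀ ⟶ M) →ₗ[k] k)
    (h₁ : ∀ (b : C) (φ : ((fpYoneda k C).obj b ⟶ M) →ₗ[k] k), ∃ x : c₀ ⟶ b,
      ∀ y, θ ((fpYoneda k C).map x ≫ y) = φ y)
    (h₂ : ∀ (b : C) (x : c₀ ⟶ b), (∀ y, θ ((fpYoneda k C).map x ≫ y) = 0) ↔
      ∃ x' : c₁ ⟶ b, u ≫ x' = x) :
    finitelyPresented k Cᵒᵖ ((dualFunctor k C).obj (op M.obj)) := by
  let θ' : Module.Dual k (M.obj.obj (op c₀)) := θ ∘ₗ (fpYonedaEquiv c₀ M).symm.toLinearMap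
  have hθ' {b : C} (x : c₀ ⟶ b) (y : (fpYoneda k C).obj b ⟶ M) :
      θ' (M.obj.map x.op (fpYonedaEquiv b M y)) = θ ((fpYoneda k C).map x ≫ y) := by
    rw [← fpYonedaEquiv_map_comp]
    exact congrArg θ ((fpYonedaEquiv c₀ M).symm_apply_apply _)
  have hM : IsLinearModule M.obj := M.property.linear
  refine finitelyPresented_of_generator hM.dual u.op θ' (LinearMap.ext fun m => ?_)
    (fun X φ => ?_) fun X g hg => ?_
  · obtain ⟨y, rfl⟩ := (fpYonedaEquiv c₁ M).surjective m
    exact (hθ' u y).trans ((h₂ c₁ u).2 ⟨𝟙 _, Category.comp_id u⟩ y)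
  · obtain ⟨x, hx⟩ := h₁ X.unop
      ((show Module.Dual k (M.obj.obj X) from φ) ∘ₗ (fpYonedaEquiv X.unop M).toLinearMap)
    refine ⟨x.op, LinearMap.ext fun m => ?_⟩
    obtain ⟨y, rfl⟩ := (fpYonedaEquiv X.unop M).surjective m
    exact (hθ' x y).trans (hx y)
  · obtain ⟨x', hx'⟩ := (h₂ X.unop g.unop).1 fun y => (hθ' g.unop y).symm.trans
      (LinearMap.congr_fun hg _)
    exact ⟨x'.op, Quiver.Hom.unop_inj hx'⟩

lemma fpMod_isIso_of_app_bijective {M N : FPMod k C} (f : M ⟶ N)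
    (h : ∀ X : C, Function.Bijective (f.hom.app (op X))) : IsIso f :=
  have : IsIso ((finitelyPresented k C).ι.map f) := isIso_of_app_bijective f.hom h
  isIso_of_reflects_iso f (finitelyPresented k C).ι

variable (hdual : ∀ M : (FPMod k C)ᵒᵖ, finitelyPresented k Cᵒᵖ
  (((finitelyPresented k C).ι.op ⋙ dualFunctor k C).obj M))

lemma fpDual_faithful : (fpDual hdual).Faithful where
  map_injective h := Quiver.Hom.unop_inj (ObjectProperty.hom_ext _
    (dualFunctor_map_injective (congrArg (fun f => f.hom) h)))

lemma fpDual_map_zero (M N : FPMod k C) : (fpDual hdual).map (0 : M ⟶ N).op = 0 := by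
  refine ObjectProperty.hom_ext _ ?_
  ext X (φ : Module.Dual k (N.obj.obj X.unop))
  exact LinearMap.ext fun x => map_zero φ

variable [∀ X Y : C, Module.Finite k (X ⟶ Y)]

lemma fpDual_full : (fpDual hdual).Full where
  map_surjective {M N} α := by
    have (X : Cᵒᵖ) : Module.Finite k (M.unop.obj.obj X) := finite_obj M.unop X.unop
    obtain ⟨f, hf⟩ := dualFunctor_map_surjective (M := N.unop.obj) (N := M.unop.obj) α.hom
    exact ⟨(ObjectProperty.homMk f : N.unop ⟶ M.unop).op, ObjectProperty.hom_ext _ hf⟩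

/-- The hypotheses make C(c, b) × I(b) → k perfect, and `τ`, viewed in (DI)(c), induces C(c, -) ≅
DI. -/
lemma exists_fpDual_iso_of_trace (c : C) (I : FPMod k C)
    (τ : ((fpYoneda k C).obj c ⟶ I) →ₗ[k] k)
    (left : ∀ (b : C) (x : c ⟶ b), (∀ z, τ ((fpYoneda k C).map x ≫ z) = 0) → x = 0)
    (right : ∀ (b : C) (z : (fpYoneda k C).obj b ⟶ I),
      (∀ x, τ ((fpYoneda k C).map x ≫ z) = 0) → z = 0) :
    Nonempty ((fpYoneda k Cᵒᵖ).obj (op c) ≅ (fpDual hdual).obj (op I)) := by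
  let θ : Module.Dual k (I.obj.obj (op c)) := τ ∘ₗ (fpYonedaEquiv c I).symm.toLinearMap
  have hθ {b : C} (x : c ⟶ b) (y : (fpYoneda k C).obj b ⟶ I) :
      θ (I.obj.map x.op (fpYonedaEquiv b I y)) = τ ((fpYoneda k C).map x ≫ y) := by
    rw [← fpYonedaEquiv_map_comp]
    exact congrArg τ ((fpYonedaEquiv c I).symm_apply_apply _)
  let e := (fpYonedaEquiv (op c) ((fpDual hdual).obj (op I))).symm θ
  have he {b : C} (x : c ⟶ b) (y : (fpYoneda k C).obj b ⟶ I) :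
      (show Module.Dual k (I.obj.obj (op b)) from e.hom.app (op (op b)) x.op)
        (fpYonedaEquiv b I y) = τ ((fpYoneda k C).map x ≫ y) := hθ x y
  have : IsIso e := by
    refine fpMod_isIso_of_app_bijective e fun X => ?_
    let B : (c ⟶ X.unop) →ₗ[k] ((fpYoneda k C).obj X.unop ⟶ I) →ₗ[k] k :=
      LinearMap.mk₂ k (fun x y => τ ((fpYoneda k C).map x ≫ y))
        (fun x x' y => by
          rw [← map_add, ← Preadditive.add_comp, Functor.map_add])
        (fun a x y => by
          rw [← map_smul, ← Linear.smul_comp, Functor.map_smul])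
        (fun x y y' => by rw [← map_add, Preadditive.comp_add])
        (fun a x y => by rw [← map_smul, Linear.comp_smul])
    have hB : B.IsPerfPair := .of_injective
      ((injective_iff_map_eq_zero _).2 fun x hx => left _ x fun z => LinearMap.congr_fun hx z)
      ((injective_iff_map_eq_zero _).2 fun z hz => right _ z fun x => LinearMap.congr_fun hz x)
    have hBe (x : c ⟶ X.unop) : (fpYonedaEquiv X.unop I).toLinearMap.dualMap
        (e.hom.app (op X) x.op) = B x := LinearMap.ext fun y => he x y
    have hd : Function.Bijective (fpYonedaEquiv X.unop I).toLinearMap.dualMap :=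
      (fpYonedaEquiv X.unop I).dualMap.bijective
    constructor
    · intro x y hxy
      refine Quiver.Hom.unop_inj (hB.bijective_left.1 ?_)
      exact (hBe _).symm.trans ((congrArg _ hxy).trans (hBe _))
    · intro φ
      obtain ⟨x, hx⟩ := hB.bijective_left.2 ((fpYonedaEquiv X.unop I).toLinearMap.dualMap φ)
      exact ⟨x.op, hd.1 ((hBe x).trans hx)⟩
  exact ⟨asIso e⟩

/-- By fullness a presentation of N is D of a map J → I; D is pointwise exact, so N is D of its
kernel. -/
lemma fpDual_essSurj [HasKernels (FPMod k C)]
    (h : ∀ c : C, ∃ I : FPMod k C,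
      Nonempty ((fpYoneda k Cᵒᵖ).obj (op c) ≅ (fpDual hdual).obj (op I))) :
    (fpDual hdual).EssSurj where
  mem_essImage N := by
    let F := fpDual hdual
    have : F.Full := fpDual_full hdual
    have : F.Faithful := fpDual_faithful hdual
    obtain ⟨A, B, f, p, w, hS, hp⟩ := N.property
    obtain ⟨I, ⟨e⟩⟩ := h A.unop
    obtain ⟨J, ⟨e'⟩⟩ := h B.unop
    obtain ⟨g, hg⟩ := F.map_surjective (e.inv ≫ (fpYoneda k Cᵒᵖ).map f ≫ e'.hom)
    let K := kernel g.unop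
    let i : K ⟶ J := kernel.ι g.unop
    let q : (fpYoneda k Cᵒᵖ).obj B ⟶ F.obj (op K) := e'.hom ≫ F.map i.op
    have hq : (fpYoneda k Cᵒᵖ).map f ≫ q = 0 := by
      have : (fpYoneda k Cᵒᵖ).map f ≫ e'.hom = e.hom ≫ F.map g := by
        rw [hg, e.hom_inv_id_assoc]
      have h₀ : g ≫ i.op = (0 : K ⟶ I).op := Quiver.Hom.unop_inj (kernel.condition g.unop)
      rw [← Category.assoc, this, Category.assoc, ← F.map_comp, h₀, fpDual_map_zero, comp_zero]
    let ψ : N.obj ⟶ (F.obj (op K)).obj := hS.desc q.hom (congrArg (fun f => f.hom) hq)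
    have hψ (X : Cᵒᵖ) (y : X ⟶ B) : ψ.app (op X) (p.app (op X) y) = q.hom.app (op X) y :=
      ConcreteCategory.congr_hom (NatTrans.congr_app
        (hS.g_desc q.hom (congrArg (fun f => f.hom) hq)) (op X)) y
    have iso_surj {M N : FPMod k Cᵒᵖ} (e : M ≅ N) (X : Cᵒᵖ) (y : N.obj.obj (op X)) :
        e.hom.hom.app (op X) (e.inv.hom.app (op X) y) = y :=
      ConcreteCategory.congr_hom (NatTrans.congr_app
        (congrArg (fun f => f.hom) e.inv_hom_id) (op X)) y
    have iso_inj {M N : FPMod k Cᵒᵖ} (e : M ≅ N) (X : Cᵒᵖ) (y : M.obj.obj (op X)) :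
        e.inv.hom.app (op X) (e.hom.hom.app (op X) y) = y := iso_surj e.symm X y
    have : IsIso ψ := by
      refine isIso_of_app_bijective ψ fun X => ⟨(injective_iff_map_eq_zero _).2 fun n hn => ?_,
        fun φ => ?_⟩
      · obtain ⟨y, rfl⟩ := app_surjective_of_epi p X n
        let z : Module.Dual k (J.obj.obj X) := e'.hom.hom.app (op X) y
        have hz : z ∘ₗ (i.hom.app X).hom = 0 := (hψ X y).symm.trans hn
        -- By Yoneda, K(X) is the whole kernel of J(X) → I(X), so a functional vanishing on K(X)
        -- factors through I(X).
        obtain ⟨ψ', hψ'⟩ := exists_factor_of_ker (g.unop.hom.app X).hom z fun x hx => by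
          obtain ⟨x, rfl⟩ := (fpYonedaEquiv X.unop J).surjective x
          have hx' : x ≫ g.unop = 0 := (fpYonedaEquiv X.unop I).injective
            (hx.trans (map_zero _).symm)
          have := LinearMap.congr_fun hz (fpYonedaEquiv X.unop K (kernel.lift _ x hx'))
          refine Eq.trans (congrArg z ?_) this
          exact congrArg (fpYonedaEquiv X.unop J) (kernel.lift_ι _ x hx').symm
        have h₁ : (F.map g).hom.app (op X) ψ' = z := LinearMap.ext hψ'
        have h₂ : y = ((fpYoneda k Cᵒᵖ).map f).hom.app (op X) (e.inv.hom.app (op X) ψ') := by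
          rw [← iso_inj e' X y]
          refine (congrArg (e'.inv.hom.app (op X)) (h₁.symm.trans ?_)).trans (iso_inj e' X _)
          rw [hg]
          rfl
        rw [h₂]
        exact ConcreteCategory.congr_hom (NatTrans.congr_app w (op X)) _
      · obtain ⟨φ', hφ'⟩ := LinearMap.dualMap_surjective_of_injective
          (f := (i.hom.app X).hom) (fpMod_app_injective i X.unop) φ
        refine ⟨p.app (op X) (e'.inv.hom.app (op X) φ'), (hψ X _).trans ?_⟩
        exact (congrArg ((F.map i.op).hom.app (op X)) (iso_surj e' X φ')).trans hφ'
    have e₀ : (F.obj (op K)).obj ≅ N.obj := (asIso ψ).symm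
    exact ⟨op K, ⟨(finitelyPresented k Cᵒᵖ).ι.preimageIso e₀⟩⟩

end

section

variable {k : Type v} [Field k] {C : Type u} [Category.{v} C] [Preadditive C] [Linear k C]

/-- Serre duality is needed twice: for D to preserve finite presentation, and for its image to
contain the representables. -/
theorem isDualizing_of_abelianHasSerreDuality [hC : IsFiniteVariety k C]
    (h : IsAbelian (FPMod k C)) (hh : letI := h.toAbelian; IsHereditary (FPMod k C))
    (hS : letI := h.toAbelian; AbelianHasSerreDuality k (FPMod k C)) : IsDualizing k C := by
  let := h.toAbelian
  let := HasDerivedCategory.standard (FPMod k C)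
  have := hC.homFinite
  have := hC.isIdempotentComplete
  have := hC.hasFiniteBiproducts
  have := hasBinaryBiproducts_of_finite_biproducts C
  let Y := fpYoneda k C
  have hdual (M : (FPMod k C)ᵒᵖ) : finitelyPresented k Cᵒᵖ
      (((finitelyPresented k C).ι.op ⋙ dualFunctor k C).obj M) := by
    obtain ⟨c₀, c₁, u, θ, hθ⟩ := exists_dual_presentation k Y.obj hS hh
      (fun M => by
        obtain ⟨B, p, hp⟩ := exists_epi_fpYoneda M
        exact ⟨B, p, fpMod_epi_of_app_surjective p hp⟩)
      (fun c N i r hir => exists_iso_of_retract Y i r hir) M.unop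
    obtain ⟨u, rfl⟩ := Y.map_surjective u
    refine finitelyPresented_dual_of_presentation M.unop u θ (fun b φ => ?_) (fun b x => ?_)
    · obtain ⟨x, hx⟩ := (hθ (Y.obj b)).1 φ
      obtain ⟨x, rfl⟩ := Y.map_surjective x
      exact ⟨x, hx⟩
    · rw [(hθ (Y.obj b)).2 (Y.map x)]
      constructor
      · rintro ⟨x', hx'⟩
        obtain ⟨x', rfl⟩ := Y.map_surjective x'
        exact ⟨x', Y.map_injective ((Y.map_comp _ _).trans hx')⟩
      · rintro ⟨x', rfl⟩
        exact ⟨Y.map x', (Y.map_comp _ _).symm⟩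
  have := fpDual_faithful hdual
  have := fpDual_full hdual
  have := h.hasKernels
  have := fpDual_essSurj hdual fun c => by
    obtain ⟨I, τ, hτ⟩ := exists_trace_of_projective k hS (Y.obj c)
    refine ⟨I, exists_fpDual_iso_of_trace hdual c I τ (fun b x hx => Y.map_injective ?_)
      (fun b z hz => (hτ (Y.obj b)).2 z fun x => ?_)⟩
    · exact ((hτ (Y.obj b)).1 (Y.map x) hx).trans (Y.map_zero _ _).symm
    · obtain ⟨x, rfl⟩ := Y.map_surjective x
      exact hz x
  exact ⟨hC, hdual, {}⟩

end

end FiniteVariety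

theorem mainTheorem4 (k : Type v) [Field k] [IsAlgClosed k] (𝔞 : Type u) [Category.{v} 𝔞]
    [Preadditive 𝔞] [Linear k 𝔞] [FiniteVariety.IsFiniteVariety k 𝔞] :
    (∃ h : FiniteVariety.IsAbelian (FiniteVariety.FPMod k 𝔞),
      letI : Abelian (FiniteVariety.FPMod k 𝔞) := h.toAbelian
      FiniteVariety.IsHereditary (FiniteVariety.FPMod k 𝔞) ∧
        FiniteVariety.AbelianHasSerreDuality k (FiniteVariety.FPMod k 𝔞)) ↔
      (FiniteVariety.IsSemiHereditary k 𝔞 ∧ FiniteVariety.IsDualizing k 𝔞) := by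
  constructor
  · rintro ⟨h, hh, hS⟩
    exact ⟨⟨h, hh⟩, FiniteVariety.isDualizing_of_abelianHasSerreDuality h hh hS⟩
  · rintro ⟨⟨h, hh⟩, hD⟩
    exact ⟨h, hh, FiniteVariety.abelianHasSerreDuality_of_isDualizing hD h hh⟩
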